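/- **Setting.** An *edge* in $\mathbb{R}^d$ is a linear interpolation between two points. A *polygonal curve* $P:[0,1]\to\mathbb{R}^d$ is the concatenation of the edges between consecutive points of a finite sequence of at least two points (its vertices), each edge being traversed linearly on a parameter interval of positive length; its *complexity* is the number of its vertices, and $\mathbb{X}^d_\ell$ is the set of polygonal curves of complexity at most $\ell$. For $0\le s\le t\le 1$, $P[s,t]$ is the subcurve of $P$ from $s$ to $t$ (reparametrized over $[0,1]$); its complexity $|P[s,t]|$ is $2$ plus the number of vertices of $P$ with parameter in $(s,t)$; $\overline{P[s,t]}$ is its reversal. Let $$d_F(p,q)=\inf_{f,g}\max_{t\in[0,1]}\|p(f(t))-q(g(t))\|,$$ where $f,g$ range over the non-decreasing surjections $[0,1]\to[0,1]$. For a curve $q$ and $\delta\ge 0$ let $\mathrm{Cov}_P(q,\delta)=\bigcup\{[s,t] : 0\le s\le t\le 1,\ d_F(P[s,t],q)\le\delta\}$. Fix an integer $\ell\ge 2$ and reals $\Delta>0$, $\alpha\ge 1$. A polygonal curve $S$ is a *simplification* of $P$ if $d_F(S,P)\le 2\Delta$, and for every $Q\in\mathbb{X}^d_\ell$ and every subcurve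 $P[s,t]$ with $d_F(Q,P[s,t])\le\Delta$ there is a subcurve $S[s',t']$ with $d_F(P[s,t],S[s',t'])\le 2\Delta$ and $|S[s',t']|\le\ell+2$. The $\delta$-*free space* of $S$ and $P$ is $D_\delta=\{(x,y)\in[0,1]^2 : \|P(x)-S(y)\|\le\delta\}$. The parameters of the vertices of $P$ (vertical lines) and of $S$ (horizontal lines) divide $[0,1]^2$ into closed rectangular *cells*. A set $A$ is an $(\alpha,\delta)$-*free space* of $S$ and $P$ if $D_\delta\subseteq A\subseteq D_{\alpha\delta}$, $A$ is convex inside the interior of every cell, and a point $p$ on the boundary of a cell is in $A$ iff for every cell $C$ containing $p$, $p$ is in the closure of $A\cap\mathrm{int}\,C$. For $0\le b\le e\le 1$, $\mathrm{Cov}_A(S[b,e])$ is the union of all $[a,c]$ such that there is a continuous path inside $A$ from $(a,b)$ to $(c,e)$ that is non-decreasing in $x$ and in $y$; $\mathrm{Cov}_A(\overline{S[b,e]})$ is the union of all $[a,c]$ such that there is a continuous path inside $A$ from $(a,e)$ to $(c,b)$ that is non-decreasing in $x$ and non-increasing in $y$. The *extremal points* of a closed $A$ in a cell $C$ are the end points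 of the (possibly degenerate) segments that consist of the points of $A\cap C$ minimizing $x$, maximizing $x$, minimizing $y$ and maximizing $y$, respectively. For every edge $e$ of $S$, with parameter interval $[u_e,v_e]$, let $\mathcal{E}_e=\{\varepsilon_1<\varepsilon_2<\dots\}\subset[u_e,v_e]$ be a finite superset of the $y$-coordinates of the extremal points of $A$ in the cells $C$ belonging to $e$. These sets induce the following subcurves of $S$. * Type (I): the subcurve of $S$ from its $i$-th to its $(i+2^m)$-th vertex, $0\le m\le\lfloor\log_2\ell\rfloor$. * Type (II): $S[u_e,\varepsilon_i]$ and $S[\varepsilon_i,v_e]$ for an edge $e$ and $\varepsilon_i\in\mathcal{E}_e$, and their reversals. * Type (III): $S[\varepsilon_i,\varepsilon_{i+2^m}]$ for an edge $e$ and $\varepsilon_i,\varepsilon_{i+2^m}\in\mathcal{E}_e$, $0\le m\le\lfloor\log_2|\mathcal{E}_e|\rfloor$, and their reversals. **Theorem.** Let $P$ be a polygonal curve in $\mathbb{R}^d$, let $S$ be a simplification of $P$, and let $A$ be a closed $(\alpha,4\Delta)$-free space of $S$ and $P$. For every edge $e$ of $S$ let $\mathcal{E}_e$ be a finite superset of extremal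 $y$-coordinates as above, and let $C$ be the set of the induced Type (I)-, (II)- and (III)-subcurves of $S$ of complexity at most $\ell$. Then for every curve $\pi\in\mathbb{X}^d_\ell$ there is a set $S_\pi\subseteq C$ with $|S_\pi|\le 8$ such that $$\mathrm{Cov}_P(\pi,\Delta)\subseteq\bigcup_{s\in S_\pi}\mathrm{Cov}_A(s)\subseteq\bigcup_{s\in S_\pi}\mathrm{Cov}_P(s,4\alpha\Delta).$$ -/

import Mathlib

open scoped unitInterval

/-- A polygonal curve in `ℝ^d` with `numEdges + 1` vertices, parametrized over `[0,1]`.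
The `i`-th vertex is the point at parameter `knot i`, and between two consecutive knots the curve is
the linear interpolation of the two vertices. Only the values of `toFun` on `[0,1]` are used. -/
structure PolygonalCurve (d : ℕ) where
  numEdges : ℕ
  knot : Fin (numEdges + 1) → ℝ
  knot_strictMono : StrictMono knot
  knot_zero : knot 0 = 0
  knot_last : knot (Fin.last numEdges) = 1
  toFun : ℝ → EuclideanSpace ℝ (Fin d)
  toFun_eq_lineMap : ∀ (i : Fin numEdges) (t : ℝ),
    t ∈ Set.Icc (knot i.castSucc) (knot i.succ) →
      toFun t = AffineMap.lineMap (toFun (knot i.castSucc)) (toFun (knot i.succ))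
        ((t - knot i.castSucc) / (knot i.succ - knot i.castSucc))

/-- The continuous Fréchet distance of two curves parametrized over `[0,1]`: the infimum of
`max_t ‖p (f t) - q (g t)‖` over all non-decreasing surjections `f, g : [0,1] → [0,1]`. -/
noncomputable def frechetDist {d : ℕ} (p q : ℝ → EuclideanSpace ℝ (Fin d)) : ENNReal :=
  ⨅ (f : {f : I → I // Monotone f ∧ Function.Surjective f})
    (g : {g : I → I // Monotone g ∧ Function.Surjective g}),
      ⨆ t : I, edist (p (f.1 t)) (q (g.1 t))

namespace PolygonalCurve

variable {d : ℕ}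

/-- The complexity: the number of vertices. -/
def complexity (P : PolygonalCurve d) : ℕ := P.numEdges + 1

/-- For `s ≤ t` this is the subcurve `P[s,t]`, reparametrized over `[0,1]`;
for `s > t` it is the reversal of the subcurve `P[t,s]`. -/
def sub (P : PolygonalCurve d) (s t : ℝ) : ℝ → EuclideanSpace ℝ (Fin d) :=
  fun u => P.toFun (s + u * (t - s))

/-- The complexity of the subcurve of `P` between the parameters `s` and `t` (in either order):
its two end points and the vertices of `P` strictly in between. -/
noncomputable def subComplexity (P : PolygonalCurve d) (s t : ℝ) : ℕ :=
  {i | P.knot i ∈ Set.Ioo (min s t) (max s t)}.ncard + 2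

/-- The `δ`-coverage of the curve `q` on `P`. -/
def cov (P : PolygonalCurve d) (q : ℝ → EuclideanSpace ℝ (Fin d)) (δ : ℝ) : Set ℝ :=
  {x | ∃ s t : ℝ, 0 ≤ s ∧ s ≤ t ∧ t ≤ 1 ∧ frechetDist (P.sub s t) q ≤ ENNReal.ofReal δ ∧
    x ∈ Set.Icc s t}

/-- `S` is a simplification of `P` (with respect to `Δ` and `ℓ`). -/
def IsSimplification (Δ : ℝ) (ℓ : ℕ) (S P : PolygonalCurve d) : Prop :=
  frechetDist S.toFun P.toFun ≤ ENNReal.ofReal (2 * Δ) ∧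
  ∀ Q : PolygonalCurve d, Q.complexity ≤ ℓ → ∀ s t : ℝ, 0 ≤ s → s ≤ t → t ≤ 1 →
    frechetDist Q.toFun (P.sub s t) ≤ ENNReal.ofReal Δ →
    ∃ s' t' : ℝ, 0 ≤ s' ∧ s' ≤ t' ∧ t' ≤ 1 ∧
      frechetDist (P.sub s t) (S.sub s' t') ≤ ENNReal.ofReal (2 * Δ) ∧
      S.subComplexity s' t' ≤ ℓ + 2

/-- The `δ`-free space of `S` and `P`: `x` is the parameter on `P`, `y` the parameter on `S`. -/
def freeSpace (S P : PolygonalCurve d) (δ : ℝ) : Set (ℝ × ℝ) :=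
  {z | z.1 ∈ Set.Icc (0 : ℝ) 1 ∧ z.2 ∈ Set.Icc (0 : ℝ) 1 ∧ ‖P.toFun z.1 - S.toFun z.2‖ ≤ δ}

/-- The (closed) cell of the free space diagram of `S` and `P` which belongs to
the `j`-th edge of `S` and the `i`-th edge of `P`. -/
def cell (S P : PolygonalCurve d) (j : Fin S.numEdges) (i : Fin P.numEdges) : Set (ℝ × ℝ) :=
  Set.Icc (P.knot i.castSucc) (P.knot i.succ) ×ˢ Set.Icc (S.knot j.castSucc) (S.knot j.succ)

/-- `A` is an `(α, δ)`-free space of `S` and `P`. -/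
structure IsApproxFreeSpace (α δ : ℝ) (S P : PolygonalCurve d) (A : Set (ℝ × ℝ)) : Prop where
  freeSpace_subset : S.freeSpace P δ ⊆ A
  subset_freeSpace : A ⊆ S.freeSpace P (α * δ)
  convex_interior : ∀ j i, Convex ℝ (A ∩ interior (S.cell P j i))
  mem_iff_of_mem_frontier : ∀ j i, ∀ p ∈ frontier (S.cell P j i),
    (p ∈ A ↔ ∀ j' i', p ∈ S.cell P j' i' → p ∈ closure (A ∩ interior (S.cell P j' i')))

/-- There is a continuous path inside `A` from `(a, b)` to `(c, e)` which is non-decreasing in `x`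
and monotone in `y`, that is, non-decreasing in `y` if `b ≤ e` and non-increasing in `y` if
`e ≤ b` (the latter is a monotone path after mirroring `A` along the `x`-axis). -/
def MonotonePath (A : Set (ℝ × ℝ)) (a b c e : ℝ) : Prop :=
  ∃ f g : ℝ → ℝ, ContinuousOn f (Set.Icc 0 1) ∧ ContinuousOn g (Set.Icc 0 1) ∧
    MonotoneOn f (Set.Icc 0 1) ∧ (MonotoneOn g (Set.Icc 0 1) ∨ AntitoneOn g (Set.Icc 0 1)) ∧
    f 0 = a ∧ g 0 = b ∧ f 1 = c ∧ g 1 = e ∧ ∀ t ∈ Set.Icc (0 : ℝ) 1, (f t, g t) ∈ A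

/-- The coverage `Cov_A` of the subcurve `S[b,e]` (of its reversal `rev S[e,b]` if `e < b`):
the union of all `[a,c]` with a monotone path from `(a, b)` to `(c, e)` inside `A`. -/
def covA (A : Set (ℝ × ℝ)) (b e : ℝ) : Set ℝ :=
  {x | ∃ a c : ℝ, MonotonePath A a b c e ∧ x ∈ Set.Icc a c}

/-- The left-most points of `K`: the start and the end point of the vertical segment that consists
of all points of `K` minimizing the `x`-coordinate. -/
def leftmostPoints (K : Set (ℝ × ℝ)) : Set (ℝ × ℝ) :=
  {p ∈ K | (∀ q ∈ K, p.1 ≤ q.1) ∧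
    ((∀ q ∈ K, q.1 = p.1 → p.2 ≤ q.2) ∨ (∀ q ∈ K, q.1 = p.1 → q.2 ≤ p.2))}

/-- The right-most points of `K`. -/
def rightmostPoints (K : Set (ℝ × ℝ)) : Set (ℝ × ℝ) :=
  {p ∈ K | (∀ q ∈ K, q.1 ≤ p.1) ∧
    ((∀ q ∈ K, q.1 = p.1 → p.2 ≤ q.2) ∨ (∀ q ∈ K, q.1 = p.1 → q.2 ≤ p.2))}

/-- The bottom-most points of `K`. -/
def bottommostPoints (K : Set (ℝ × ℝ)) : Set (ℝ × ℝ) :=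
  {p ∈ K | (∀ q ∈ K, p.2 ≤ q.2) ∧
    ((∀ q ∈ K, q.2 = p.2 → p.1 ≤ q.1) ∨ (∀ q ∈ K, q.2 = p.2 → q.1 ≤ p.1))}

/-- The top-most points of `K`. -/
def topmostPoints (K : Set (ℝ × ℝ)) : Set (ℝ × ℝ) :=
  {p ∈ K | (∀ q ∈ K, q.2 ≤ p.2) ∧
    ((∀ q ∈ K, q.2 = p.2 → p.1 ≤ q.1) ∨ (∀ q ∈ K, q.2 = p.2 → q.1 ≤ p.1))}

/-- The extremal points of the restriction of `A` to the `j`-th edge of `S`. -/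
def extremalPoints (S P : PolygonalCurve d) (A : Set (ℝ × ℝ)) (j : Fin S.numEdges) :
    Set (ℝ × ℝ) :=
  ⋃ i : Fin P.numEdges,
    leftmostPoints (A ∩ S.cell P j i) ∪ rightmostPoints (A ∩ S.cell P j i) ∪
      bottommostPoints (A ∩ S.cell P j i) ∪ topmostPoints (A ∩ S.cell P j i)

/-- `E j` is a finite superset of the `y`-coordinates of the extremal points of the restriction of
`A` to the `j`-th edge of `S`. The values are given as parameters of `S`, i.e. they lie in the
parameter interval of the `j`-th edge. -/
def IsExtremalSuperset (S P : PolygonalCurve d) (A : Set (ℝ × ℝ))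
    (E : Fin S.numEdges → Finset ℝ) : Prop :=
  ∀ j, Prod.snd '' S.extremalPoints P A j ⊆ (E j : Set ℝ) ∧
    (E j : Set ℝ) ⊆ Set.Icc (S.knot j.castSucc) (S.knot j.succ)

/-! A subcurve `S[b,e]` with `b ≤ e` is represented by the pair `(b, e)`, and its reversal by the
pair `(e, b)`. -/

/-- Type (I): from the `a`-th to the `(a + 2^m)`-th vertex of `S`, where `m ≤ ⌊log₂ ℓ⌋`. -/
def IsTypeI (S : PolygonalCurve d) (ℓ : ℕ) (c : ℝ × ℝ) : Prop :=
  ∃ (a b : Fin (S.numEdges + 1)) (m : ℕ), m ≤ Nat.log 2 ℓ ∧ (b : ℕ) = a + 2 ^ m ∧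
    c = (S.knot a, S.knot b)

/-- Type (II): between an end point of an edge and a value in `E` on that edge, or the reversal. -/
def IsTypeII (S : PolygonalCurve d) (E : Fin S.numEdges → Finset ℝ) (c : ℝ × ℝ) : Prop :=
  ∃ (j : Fin S.numEdges) (c' : ℝ × ℝ), (c = c' ∨ c = c'.swap) ∧
    ∃ ε ∈ E j, c' = (S.knot j.castSucc, ε) ∨ c' = (ε, S.knot j.succ)

/-- Type (III): between the `a`-th and the `(a + 2^m)`-th value of the sorted set `E` on an edge,
where `m ≤ ⌊log₂ |E|⌋`, or the reversal. -/
def IsTypeIII (S : PolygonalCurve d) (E : Fin S.numEdges → Finset ℝ) (c : ℝ × ℝ) : Prop :=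
  ∃ (j : Fin S.numEdges) (c' : ℝ × ℝ), (c = c' ∨ c = c'.swap) ∧
    ∃ (a b : Fin (E j).card) (m : ℕ), m ≤ Nat.log 2 (E j).card ∧ (b : ℕ) = a + 2 ^ m ∧
      c' = ((E j).orderEmbOfFin rfl a, (E j).orderEmbOfFin rfl b)

/-- The Type (I)-, (II)- and (III)-subcurves of `S` of complexity at most `ℓ` induced by `E`. -/
def candidates (S : PolygonalCurve d) (ℓ : ℕ) (E : Fin S.numEdges → Finset ℝ) : Set (ℝ × ℝ) :=
  {c | (S.IsTypeI ℓ c ∨ S.IsTypeII E c ∨ S.IsTypeIII E c) ∧ S.subComplexity c.1 c.2 ≤ ℓ}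

end PolygonalCurve

/-!
Let `P[s,t]` be one subcurve in the coverage of `π`. The simplification `S` has a subcurve `S[b,e]`
with at most `ℓ` inner vertices at distance at most `2Δ` from `P[s,t]`, hence at most `3Δ` from `π`,
and by the triangle inequality at most `4Δ` from *every* subcurve in the coverage of `π`. As the
infimum in the Fréchet distance is attained (`exists_matching_of_frechetDist_le`), each of these
subcurves is the `x`-range of a path in `A` from height `b` to height `e` that is non-decreasing in
both coordinates (`upPath_of_frechetDist_le`). The task is to cover the `x`-ranges of all these
paths by eight candidates.

Two overlapping steps of length `2 ^ m` lead from one vertex of `S`, or from one value of `E` on an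
edge, to any later one (`exists_upCov_subset_of_two_pow`). What remains is to move the ends `b` and
`e` to values of `E`. Two neighbouring values `ε < ε'` of `E` bound a strip with no extremal point
strictly inside. So in every cell the left and the right boundary of `A` are monotone across the
strip, and on the vertical lines between cells `A` contains the whole height of the strip once it
contains a point strictly inside. Hence the start of a path in the strip can be moved to the left,
either down to `ε` or up to `ε'`, and the end of a path can be moved to the right
(`IsStrip.exists_upPath_start`, `IsStrip.exists_upPath_end`). Which of the two applies depends on
the cell, so that each end contributes a factor of two. If `S[b,e]` contains vertices, this gives
`2 + 2 + 2` candidates; if it lies on one edge and both ends can be moved, it gives `2 * 2 * 2`.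
If the ends lie in the same or in adjacent strips, these strips, traversed upwards and downwards,
cover everything (`IsStrip.mem_covA_of_upPath`).

The delicate case is `b = e`, where all paths are horizontal (`covered_cov_of_horizontal`). They may
stay in cells in which `A` lies at height `b` only and is met by no strip. In these the distance
from `P` to `S b` is exactly `4Δ`, so that the subcurve of `P` is constant by strict convexity, and
tightness of the triangle inequality determines its value. All such subcurves are then covered
together near another point of `S`.

The second inclusion holds for every candidate separately: a monotone path in `A`, rescaled in both
coordinates, is a Fréchet matching (`covA_subset_cov`).
-/

/-! ### Polygonal curves -/

theorem PolygonalCurve.exists_edge_lt {d : ℕ} (P : PolygonalCurve d) {x : ℝ} (h0 : 0 ≤ x)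
    (h1 : x < 1) : ∃ i : Fin P.numEdges, P.knot i.castSucc ≤ x ∧ x < P.knot i.succ := by
  classical
  set T := Finset.univ.filter fun k => x < P.knot k
  have hT : T.Nonempty := ⟨Fin.last _, by simp [T, P.knot_last, h1]⟩
  have hm : x < P.knot (T.min' hT) := by simpa [T] using T.min'_mem hT
  have hne : T.min' hT ≠ 0 := by
    intro h
    rw [h, P.knot_zero] at hm
    linarith
  obtain ⟨i, hi⟩ := Fin.exists_succ_eq.2 hne
  refine ⟨i, ?_, hi ▸ hm⟩
  by_contra! hlt
  have := T.min'_le i.castSucc (by simpa [T] using hlt)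
  rw [← hi] at this
  exact absurd this (not_le.2 i.castSucc_lt_succ)

theorem PolygonalCurve.numEdges_pos {d : ℕ} (P : PolygonalCurve d) : 0 < P.numEdges := by
  obtain ⟨i, -⟩ := P.exists_edge_lt le_rfl one_pos
  exact i.pos

theorem PolygonalCurve.exists_edge {d : ℕ} (P : PolygonalCurve d) {x : ℝ}
    (hx : x ∈ Set.Icc (0 : ℝ) 1) :
    ∃ i : Fin P.numEdges, x ∈ Set.Icc (P.knot i.castSucc) (P.knot i.succ) := by
  rcases hx.2.lt_or_eq with h | rfl
  · obtain ⟨i, h1, h2⟩ := P.exists_edge_lt hx.1 h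
    exact ⟨i, h1, h2.le⟩
  · obtain ⟨i, hi⟩ := Fin.exists_succ_eq.2
      (show Fin.last P.numEdges ≠ 0 by simpa [Fin.ext_iff] using P.numEdges_pos.ne')
    have h := P.knot_strictMono i.castSucc_lt_succ
    rw [hi, P.knot_last] at h
    exact ⟨i, h.le, by rw [hi, P.knot_last]⟩

theorem PolygonalCurve.knot_mem {d : ℕ} (P : PolygonalCurve d) (k : Fin (P.numEdges + 1)) :
    P.knot k ∈ Set.Icc (0 : ℝ) 1 :=
  ⟨P.knot_zero ▸ P.knot_strictMono.monotone (Fin.zero_le k),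
    P.knot_last ▸ P.knot_strictMono.monotone (Fin.le_last k)⟩

theorem PolygonalCurve.knot_castSucc_lt {d : ℕ} (P : PolygonalCurve d) (i : Fin P.numEdges) :
    P.knot i.castSucc < P.knot i.succ :=
  P.knot_strictMono i.castSucc_lt_succ

theorem PolygonalCurve.continuousOn {d : ℕ} (P : PolygonalCurve d) :
    ContinuousOn P.toFun (Set.Icc 0 1) := by
  have h : ContinuousOn P.toFun
      (⋃ i : Fin P.numEdges, Set.Icc (P.knot i.castSucc) (P.knot i.succ)) := by
    refine (locallyFinite_of_finite _).continuousOn_iUnion (fun i => isClosed_Icc) fun i => ?_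
    refine ContinuousOn.congr (Continuous.continuousOn ?_) (P.toFun_eq_lineMap i)
    exact AffineMap.lineMap_continuous.comp (by fun_prop)
  exact h.mono fun x hx => Set.mem_iUnion.2 (P.exists_edge hx)

theorem PolygonalCurve.continuous_sub {d : ℕ} (P : PolygonalCurve d) {s t : ℝ}
    (hs : s ∈ Set.Icc (0 : ℝ) 1) (ht : t ∈ Set.Icc (0 : ℝ) 1) :
    Continuous fun u : I => P.sub s t u := by
  refine P.continuousOn.comp_continuous (by fun_prop) fun u => ?_
  have h := u.2
  constructor <;> nlinarith [h.1, h.2, hs.1, hs.2, ht.1, ht.2]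

/-! ### The Fréchet distance -/

theorem map_zero_of_monotone_surjective {f : I → I} (hf : Monotone f)
    (hs : Function.Surjective f) : f 0 = 0 := by
  obtain ⟨t, ht⟩ := hs 0
  exact le_antisymm ((hf (unitInterval.nonneg' (t := t))).trans_eq ht) unitInterval.nonneg'

theorem map_one_of_monotone_surjective {f : I → I} (hf : Monotone f)
    (hs : Function.Surjective f) : f 1 = 1 := by
  obtain ⟨t, ht⟩ := hs 1
  exact le_antisymm unitInterval.le_one' (ht.symm.trans_le (hf (unitInterval.le_one' (t := t))))

theorem frechetDist_comm {d : ℕ} (p q : ℝ → EuclideanSpace ℝ (Fin d)) :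
    frechetDist p q = frechetDist q p := by
  unfold frechetDist
  rw [iInf_comm]
  simp only [edist_comm]

theorem frechetDist_le_of_forall {d : ℕ} {p q : ℝ → EuclideanSpace ℝ (Fin d)} {f g : I → I}
    {c : ENNReal} (hf : Monotone f) (hf' : Function.Surjective f) (hg : Monotone g)
    (hg' : Function.Surjective g) (h : ∀ t, edist (p (f t)) (q (g t)) ≤ c) :
    frechetDist p q ≤ c :=
  iInf_le_of_le ⟨f, hf, hf'⟩ (iInf_le_of_le ⟨g, hg, hg'⟩ (iSup_le h))

theorem exists_of_frechetDist_lt {d : ℕ} {p q : ℝ → EuclideanSpace ℝ (Fin d)} {c : ENNReal}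
    (h : frechetDist p q < c) :
    ∃ f g : I → I, Monotone f ∧ Function.Surjective f ∧ Monotone g ∧ Function.Surjective g ∧
      ∀ t, edist (p (f t)) (q (g t)) ≤ c := by
  simp only [frechetDist, iInf_lt_iff] at h
  obtain ⟨f, g, h⟩ := h
  exact ⟨f.1, g.1, f.2.1, f.2.2, g.2.1, g.2.2, fun t =>
    (le_iSup (fun t => edist (p (f.1 t)) (q (g.1 t))) t).trans h.le⟩

theorem edist_zero_le_frechetDist {d : ℕ} (p q : ℝ → EuclideanSpace ℝ (Fin d)) :
    edist (p 0) (q 0) ≤ frechetDist p q := by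
  refine le_iInf fun f => le_iInf fun g => ?_
  have h := le_iSup (fun t => edist (p (f.1 t)) (q (g.1 t))) 0
  rwa [map_zero_of_monotone_surjective f.2.1 f.2.2,
    map_zero_of_monotone_surjective g.2.1 g.2.2] at h

/-- A non-decreasing surjection of `[0,1]` becomes strictly increasing, hence an order isomorphism,
after an arbitrarily small admixture of the identity. -/
theorem exists_orderIso_dist_le {f : I → I} (hf : Monotone f) (hs : Function.Surjective f)
    {η : ℝ} (hη : 0 < η) : ∃ h : I ≃o I, ∀ t, dist (h t) (f t) ≤ η := by
  obtain ⟨θ, hθ0, hθ⟩ : ∃ θ : ℝ, 0 < θ ∧ θ ≤ min η 1 := ⟨min η 1, by positivity, le_rfl⟩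
  have hθη := hθ.trans (min_le_left _ _)
  have hθ1 := hθ.trans (min_le_right _ _)
  have hmem : ∀ t : I, (1 - θ) * (f t : ℝ) + θ * t ∈ I := fun t => by
    have h1 := (f t).2
    have h2 := t.2
    constructor <;> nlinarith [h1.1, h1.2, h2.1, h2.2]
  let k : I → I := fun t => ⟨(1 - θ) * (f t : ℝ) + θ * t, hmem t⟩
  have hk : StrictMono k := fun a b hab => by
    have h1 : (f a : ℝ) ≤ f b := hf hab.le
    have h2 : (a : ℝ) < b := hab
    change (1 - θ) * (f a : ℝ) + θ * a < (1 - θ) * (f b : ℝ) + θ * b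
    nlinarith
  have hfc : Continuous f := hf.continuous_of_surjective hs
  have hkc : Continuous k := by
    refine Continuous.subtype_mk ?_ _
    fun_prop
  have hk0 : k 0 = 0 := Subtype.ext (by simp [k, map_zero_of_monotone_surjective hf hs])
  have hk1 : k 1 = 1 := Subtype.ext (by simp [k, map_one_of_monotone_surjective hf hs])
  have hks : Function.Surjective k := fun y => by
    refine mem_range_of_exists_le_of_exists_ge hkc ⟨0, ?_⟩ ⟨1, ?_⟩
    · rw [hk0]; exact unitInterval.nonneg'
    · rw [hk1]; exact unitInterval.le_one'
  refine ⟨hk.orderIsoOfSurjective k hks, fun t => ?_⟩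
  rw [Subtype.dist_eq, Real.dist_eq]
  change |(1 - θ) * (f t : ℝ) + θ * t - f t| ≤ η
  have h1 := (f t).2
  have h2 := t.2
  rw [abs_le]
  constructor <;> nlinarith [h1.1, h1.2, h2.1, h2.2]

/-- The triangle inequality. The parametrizations of the middle curve `r` are perturbed to order
isomorphisms, so that they can be inverted and composed; by the uniform continuity of `r` this
costs arbitrarily little. -/
theorem frechetDist_triangle {d : ℕ} {p r q : ℝ → EuclideanSpace ℝ (Fin d)}
    (hr : Continuous fun t : I => r t) :
    frechetDist p q ≤ frechetDist p r + frechetDist r q := by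
  by_cases htop : frechetDist p r = ⊤ ∨ frechetDist r q = ⊤
  · rcases htop with h | h <;> simp [h]
  push Not at htop
  refine ENNReal.le_of_forall_pos_le_add fun η hη _ => ?_
  have hη4 : (0 : ENNReal) < η / 4 := ENNReal.div_pos (by simpa using hη.ne') (by simp)
  obtain ⟨f, g, hf, hf', hg, hg', h1⟩ :=
    exists_of_frechetDist_lt (ENNReal.lt_add_right htop.1 hη4.ne')
  obtain ⟨f₂, g₂, hf₂, hf₂', hg₂, hg₂', h2⟩ :=
    exists_of_frechetDist_lt (ENNReal.lt_add_right htop.2 hη4.ne')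
  have huc := CompactSpace.uniformContinuous_of_continuous hr
  obtain ⟨θ, hθ, hθ'⟩ := Metric.uniformContinuous_iff.1 huc (η / 4) (by positivity)
  have hclose : ∀ a b : I, dist a b ≤ θ / 2 → edist (r a) (r b) ≤ η / 4 := fun a b hab => by
    have h := (hθ' (lt_of_le_of_lt hab (by linarith))).le
    rw [edist_dist]
    refine (ENNReal.ofReal_le_ofReal h).trans_eq ?_
    rw [ENNReal.ofReal_div_of_pos (by norm_num)]
    simp
  obtain ⟨k, hk⟩ := exists_orderIso_dist_le hg hg' (half_pos hθ)
  obtain ⟨k₂, hk₂⟩ := exists_orderIso_dist_le hf₂ hf₂' (half_pos hθ)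
  refine frechetDist_le_of_forall (hf.comp k.symm.monotone) (hf'.comp k.symm.surjective)
    (hg₂.comp k₂.symm.monotone) (hg₂'.comp k₂.symm.surjective) fun u => ?_
  have e1 := hclose _ _ (hk (k.symm u))
  have e2 := hclose _ _ (hk₂ (k₂.symm u))
  rw [k.apply_symm_apply] at e1
  rw [k₂.apply_symm_apply] at e2
  have hsum : frechetDist p r + η / 4 + η / 4 + (η / 4 + (frechetDist r q + η / 4)) =
      frechetDist p r + frechetDist r q + η := by
    have : (η : ENNReal) = η / 4 + η / 4 + (η / 4 + η / 4) := by
      have h4 : (η : ENNReal) / 4 = (η / 2) / 2 := by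
        rw [div_eq_mul_inv, div_eq_mul_inv, div_eq_mul_inv, mul_assoc, ← ENNReal.mul_inv] <;>
          norm_num
      rw [h4, ENNReal.add_halves, ENNReal.add_halves]
    conv_rhs => rw [this]
    ring
  calc edist (p (f (k.symm u))) (q (g₂ (k₂.symm u)))
      ≤ edist (p (f (k.symm u))) (r u) + edist (r u) (q (g₂ (k₂.symm u))) := edist_triangle _ _ _
    _ ≤ (edist (p (f (k.symm u))) (r (g (k.symm u))) + edist (r (g (k.symm u))) (r u)) +
        (edist (r u) (r (f₂ (k₂.symm u))) +
          edist (r (f₂ (k₂.symm u))) (q (g₂ (k₂.symm u)))) :=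
        add_le_add (edist_triangle _ _ _) (edist_triangle _ _ _)
    _ ≤ (frechetDist p r + η / 4 + η / 4) + (η / 4 + (frechetDist r q + η / 4)) := by
        gcongr
        · exact h1 _
        · rw [edist_comm]; exact e1
        · exact h2 _
    _ = _ := hsum

/-- Two non-decreasing surjections `f, g` of `[0,1]`, reparametrized by their mean. -/
theorem exists_reparam_add_eq {f g : I → I} (hf : Monotone f) (hf' : Function.Surjective f)
    (hg : Monotone g) (hg' : Function.Surjective g) :
    ∃ ρ : I → I, Monotone (f ∘ ρ) ∧ Monotone (g ∘ ρ) ∧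
      ∀ u, (f (ρ u) : ℝ) + g (ρ u) = 2 * u := by
  have hmem : ∀ t : I, ((f t : ℝ) + g t) / 2 ∈ I := fun t => by
    have h1 := (f t).2
    have h2 := (g t).2
    constructor <;> linarith [h1.1, h1.2, h2.1, h2.2]
  let τ : I → I := fun t => ⟨((f t : ℝ) + g t) / 2, hmem t⟩
  have hτ : Monotone τ := fun a b hab => by
    have h1 : (f a : ℝ) ≤ f b := hf hab
    have h2 : (g a : ℝ) ≤ g b := hg hab
    change ((f a : ℝ) + g a) / 2 ≤ ((f b : ℝ) + g b) / 2
    linarith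
  have hfc : Continuous f := hf.continuous_of_surjective hf'
  have hgc : Continuous g := hg.continuous_of_surjective hg'
  have hτc : Continuous τ := by
    refine Continuous.subtype_mk ?_ _
    fun_prop
  have hτ0 : τ 0 = 0 := Subtype.ext (by
    simp [τ, map_zero_of_monotone_surjective hf hf', map_zero_of_monotone_surjective hg hg'])
  have hτ1 : τ 1 = 1 := Subtype.ext (by
    simp [τ, map_one_of_monotone_surjective hf hf', map_one_of_monotone_surjective hg hg'])
  have hτs : Function.Surjective τ := fun y => by
    refine mem_range_of_exists_le_of_exists_ge hτc ⟨0, ?_⟩ ⟨1, ?_⟩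
    · rw [hτ0]; exact unitInterval.nonneg'
    · rw [hτ1]; exact unitInterval.le_one'
  obtain ⟨ρ, hρ⟩ := hτs.hasRightInverse
  have hρm : Monotone ρ := by
    refine StrictMono.monotone fun a b hab => ?_
    by_contra! h
    have := hτ h
    rw [hρ, hρ] at this
    exact absurd hab (not_lt.2 this)
  refine ⟨ρ, hf.comp hρm, hg.comp hρm, fun u => ?_⟩
  have h : ((f (ρ u) : ℝ) + g (ρ u)) / 2 = u := congrArg Subtype.val (hρ u)
  linarith

/-- The infimum in the Fréchet distance is attained: parametrized by the mean of the two
coordinates, the near-optimal matchings form a decreasing sequence of nonempty closed subsets of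
the compact space `(I → I) × (I → I)`. -/
theorem exists_matching_of_frechetDist_le {d : ℕ} {p q : ℝ → EuclideanSpace ℝ (Fin d)} {δ : ℝ}
    (hδ : 0 ≤ δ) (hp : Continuous fun t : I => p t) (hq : Continuous fun t : I => q t)
    (h : frechetDist p q ≤ ENNReal.ofReal δ) :
    ∃ F G : I → I, Monotone F ∧ Monotone G ∧ (∀ u, (F u : ℝ) + G u = 2 * u) ∧
      ∀ u, dist (p (F u)) (q (G u)) ≤ δ := by
  let K : ℕ → Set ((I → I) × (I → I)) := fun n =>
    {z | (∀ u v, u ≤ v → z.1 u ≤ z.1 v) ∧ (∀ u v, u ≤ v → z.2 u ≤ z.2 v) ∧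
      (∀ u, (z.1 u : ℝ) + z.2 u = 2 * u) ∧
      ∀ u, dist (p (z.1 u)) (q (z.2 u)) ≤ δ + 1 / ((n : ℝ) + 1)}
  have hcl : ∀ n, IsClosed (K n) := fun n => by
    have c1 : ∀ u, Continuous fun z : (I → I) × (I → I) => z.1 u := fun u => by fun_prop
    have c2 : ∀ u, Continuous fun z : (I → I) × (I → I) => z.2 u := fun u => by fun_prop
    refine IsClosed.inter ?_ (IsClosed.inter ?_ (IsClosed.inter ?_ ?_))
    · change IsClosed {z : (I → I) × (I → I) | _}
      simp only [Set.ofPred_forall]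
      exact isClosed_iInter fun u => isClosed_iInter fun v => isClosed_iInter fun _ =>
        isClosed_le (c1 u) (c1 v)
    · change IsClosed {z : (I → I) × (I → I) | _}
      simp only [Set.ofPred_forall]
      exact isClosed_iInter fun u => isClosed_iInter fun v => isClosed_iInter fun _ =>
        isClosed_le (c2 u) (c2 v)
    · change IsClosed {z : (I → I) × (I → I) | _}
      simp only [Set.ofPred_forall]
      exact isClosed_iInter fun u => isClosed_eq
        ((continuous_subtype_val.comp (c1 u)).add (continuous_subtype_val.comp (c2 u)))
        continuous_const
    · change IsClosed {z : (I → I) × (I → I) | _}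
      simp only [Set.ofPred_forall]
      exact isClosed_iInter fun u => isClosed_le
        ((hp.comp (c1 u)).dist (hq.comp (c2 u))) continuous_const
  have hne : ∀ n, (K n).Nonempty := fun n => by
    have hn : (0 : ℝ) < 1 / ((n : ℝ) + 1) := Nat.one_div_pos_of_nat
    obtain ⟨f, g, hf, hf', hg, hg', hfg⟩ := exists_of_frechetDist_lt
      (lt_of_le_of_lt h ((ENNReal.ofReal_lt_ofReal_iff (by linarith)).2
        (show δ < δ + 1 / ((n : ℝ) + 1) by linarith)))
    obtain ⟨ρ, h1, h2, h3⟩ := exists_reparam_add_eq hf hf' hg hg'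
    refine ⟨(f ∘ ρ, g ∘ ρ), fun u v huv => h1 huv, fun u v huv => h2 huv, h3, fun u => ?_⟩
    have := hfg (ρ u)
    rwa [edist_dist, ENNReal.ofReal_le_ofReal_iff (by linarith)] at this
  have hdec : ∀ n, K (n + 1) ⊆ K n := fun n z hz => by
    refine ⟨hz.1, hz.2.1, hz.2.2.1, fun u => (hz.2.2.2 u).trans ?_⟩
    gcongr
    simp
  obtain ⟨z, hz⟩ := IsCompact.nonempty_iInter_of_sequence_nonempty_isCompact_isClosed K hdec hne
    (hcl 0).isCompact hcl
  rw [Set.mem_iInter] at hz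
  refine ⟨z.1, z.2, (hz 0).1, (hz 0).2.1, (hz 0).2.2.1, fun u => ?_⟩
  refine ge_of_tendsto' (x := Filter.atTop)
    (f := fun n : ℕ => δ + 1 / ((n : ℝ) + 1)) ?_ fun n => (hz n).2.2.2 u
  simpa using tendsto_one_div_add_atTop_nhds_zero_nat.const_add δ

/-! ### Monotone paths in the plane -/

/-- There is a continuous path from `p` to `q` inside `A`, over some compact parameter interval,
along which both coordinates are non-decreasing. -/
def UpPath (A : Set (ℝ × ℝ)) (p q : ℝ × ℝ) : Prop :=
  ∃ (t₀ t₁ : ℝ) (γ : ℝ → ℝ × ℝ), t₀ ≤ t₁ ∧ ContinuousOn γ (Set.Icc t₀ t₁) ∧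
    MonotoneOn γ (Set.Icc t₀ t₁) ∧ γ t₀ = p ∧ γ t₁ = q ∧ ∀ t ∈ Set.Icc t₀ t₁, γ t ∈ A

namespace UpPath

variable {A B : Set (ℝ × ℝ)} {p q r : ℝ × ℝ} {a b c e : ℝ}

theorem le (h : UpPath A p q) : p ≤ q := by
  obtain ⟨t₀, t₁, γ, ht, -, hm, rfl, rfl, -⟩ := h
  exact hm (Set.left_mem_Icc.2 ht) (Set.right_mem_Icc.2 ht) ht

theorem left_mem (h : UpPath A p q) : p ∈ A := by
  obtain ⟨t₀, t₁, γ, ht, -, -, rfl, -, hA⟩ := h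
  exact hA _ (Set.left_mem_Icc.2 ht)

theorem right_mem (h : UpPath A p q) : q ∈ A := by
  obtain ⟨t₀, t₁, γ, ht, -, -, -, rfl, hA⟩ := h
  exact hA _ (Set.right_mem_Icc.2 ht)

theorem mono (h : UpPath A p q) (hAB : A ⊆ B) : UpPath B p q := by
  obtain ⟨t₀, t₁, γ, ht, hc, hm, h0, h1, hA⟩ := h
  exact ⟨t₀, t₁, γ, ht, hc, hm, h0, h1, fun t ht => hAB (hA t ht)⟩

theorem map (h : UpPath A p q) {φ : ℝ × ℝ → ℝ × ℝ} (hφ : Continuous φ) (hφ' : Monotone φ)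
    (hAB : ∀ z ∈ A, φ z ∈ B) : UpPath B (φ p) (φ q) := by
  obtain ⟨t₀, t₁, γ, ht, hc, hm, rfl, rfl, hA⟩ := h
  exact ⟨t₀, t₁, φ ∘ γ, ht, hφ.comp_continuousOn hc, hφ'.comp_monotoneOn hm, rfl, rfl,
    fun t ht => hAB _ (hA t ht)⟩

theorem trans (h₁ : UpPath A p q) (h₂ : UpPath A q r) : UpPath A p r := by
  obtain ⟨t₀, t₁, γ, ht, hc, hm, rfl, rfl, hA⟩ := h₁
  obtain ⟨s₀, s₁, β, hs, hc', hm', h0, rfl, hA'⟩ := h₂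
  -- the second path is shifted so that its parameter interval starts at `t₁`
  set κ : ℝ → ℝ × ℝ := fun t => if t ≤ t₁ then γ t else β (t - t₁ + s₀) with hκ
  have e1 : Set.EqOn κ γ (Set.Icc t₀ t₁) := fun t ht => by simp [hκ, ht.2]
  have e2 : Set.EqOn κ (fun t => β (t - t₁ + s₀)) (Set.Icc t₁ (t₁ + (s₁ - s₀))) := fun t ht => by
    rcases ht.1.eq_or_lt with rfl | h
    · simp [hκ, h0]
    · simp [hκ, not_le.2 h]
  have hmaps : Set.MapsTo (fun t => t - t₁ + s₀) (Set.Icc t₁ (t₁ + (s₁ - s₀)))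
      (Set.Icc s₀ s₁) := fun t ht => ⟨by linarith [ht.1], by linarith [ht.2]⟩
  have hle : t₁ ≤ t₁ + (s₁ - s₀) := by linarith
  have hU : Set.Icc t₀ (t₁ + (s₁ - s₀)) = Set.Icc t₀ t₁ ∪ Set.Icc t₁ (t₁ + (s₁ - s₀)) :=
    (Set.Icc_union_Icc_eq_Icc ht hle).symm
  refine ⟨t₀, t₁ + (s₁ - s₀), κ, ht.trans hle, ?_, ?_, ?_, ?_, ?_⟩
  · rw [hU]
    exact (hc.congr e1).union_of_isClosed ((hc'.comp (by fun_prop) hmaps).congr e2)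
      isClosed_Icc isClosed_Icc
  · rw [hU]
    refine (hm.congr e1.symm).union_right (MonotoneOn.congr (f₁ := fun t => β (t - t₁ + s₀))
      (fun x hx y hy hxy => hm' (hmaps hx) (hmaps hy) (by simpa using hxy)) e2.symm)
      (isGreatest_Icc ht) (isLeast_Icc hle)
  · exact e1 (Set.left_mem_Icc.2 ht)
  · rw [e2 (Set.right_mem_Icc.2 hle)]
    simp
  · intro t ht'
    rw [hU] at ht'
    rcases ht' with h | h
    · rw [e1 h]; exact hA t h
    · rw [e2 h]; exact hA' _ (hmaps h)

theorem of_convex {K : Set (ℝ × ℝ)} (hK : Convex ℝ K) (hKA : K ⊆ A) (hp : p ∈ K) (hq : q ∈ K)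
    (hpq : p ≤ q) : UpPath A p q := by
  refine ⟨0, 1, AffineMap.lineMap p q, zero_le_one, AffineMap.lineMap_continuous.continuousOn, ?_,
    by simp, by simp, fun t ht => hKA (hK.lineMap_mem hp hq ht)⟩
  intro s _ t _ hst
  have h1 := hpq.1
  have h2 := hpq.2
  constructor
  · simp only [AffineMap.fst_lineMap, AffineMap.lineMap_apply_ring']
    nlinarith
  · simp only [AffineMap.snd_lineMap, AffineMap.lineMap_apply_ring']
    nlinarith

theorem of_horizontal {y : ℝ} (hac : a ≤ c) (h : ∀ x ∈ Set.Icc a c, (x, y) ∈ A) :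
    UpPath A (a, y) (c, y) := by
  refine of_convex (K := Set.Icc a c ×ˢ {y}) ((convex_Icc a c).prod (convex_singleton y)) ?_
    ⟨⟨le_rfl, hac⟩, rfl⟩ ⟨⟨hac, le_rfl⟩, rfl⟩ ⟨hac, le_rfl⟩
  rintro ⟨x, z⟩ ⟨hx, rfl⟩
  exact h x hx

theorem exists_split (h : UpPath A p q) {φ : ℝ × ℝ → ℝ} (hφ : Continuous φ) {w : ℝ}
    (hp : φ p ≤ w) (hq : w ≤ φ q) : ∃ z, φ z = w ∧ UpPath A p z ∧ UpPath A z q := by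
  obtain ⟨t₀, t₁, γ, ht, hc, hm, rfl, rfl, hA⟩ := h
  obtain ⟨t, htm, rfl⟩ := intermediate_value_Icc ht (hφ.comp_continuousOn hc) ⟨hp, hq⟩
  have i1 : Set.Icc t₀ t ⊆ Set.Icc t₀ t₁ := Set.Icc_subset_Icc_right htm.2
  have i2 : Set.Icc t t₁ ⊆ Set.Icc t₀ t₁ := Set.Icc_subset_Icc_left htm.1
  exact ⟨γ t, rfl, ⟨t₀, t, γ, htm.1, hc.mono i1, hm.mono i1, rfl, rfl, fun s hs => hA s (i1 hs)⟩,
    ⟨t, t₁, γ, htm.2, hc.mono i2, hm.mono i2, rfl, rfl, fun s hs => hA s (i2 hs)⟩⟩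

theorem exists_split_snd (h : UpPath A (a, b) (c, e)) {y : ℝ} (hb : b ≤ y) (he : y ≤ e) :
    ∃ x, UpPath A (a, b) (x, y) ∧ UpPath A (x, y) (c, e) := by
  obtain ⟨⟨x, z⟩, rfl, h1, h2⟩ := h.exists_split continuous_snd hb he
  exact ⟨x, h1, h2⟩

theorem exists_split_fst (h : UpPath A (a, b) (c, e)) {x : ℝ} (hx : x ∈ Set.Icc a c) :
    ∃ y, UpPath A (a, b) (x, y) ∧ UpPath A (x, y) (c, e) := by
  obtain ⟨⟨z, y⟩, rfl, h1, h2⟩ := h.exists_split continuous_fst hx.1 hx.2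
  exact ⟨y, h1, h2⟩

theorem monotonePath (h : UpPath A (a, b) (c, e)) : PolygonalCurve.MonotonePath A a b c e := by
  obtain ⟨t₀, t₁, γ, ht, hc, hm, h0, h1, hA⟩ := h
  have hmaps : Set.MapsTo (fun u => t₀ + u * (t₁ - t₀)) (Set.Icc (0 : ℝ) 1) (Set.Icc t₀ t₁) :=
    fun u hu => ⟨by nlinarith [hu.1, hu.2], by nlinarith [hu.1, hu.2]⟩
  have hc' := hc.comp (f := fun u => t₀ + u * (t₁ - t₀)) (by fun_prop) hmaps
  have hm' : MonotoneOn (γ ∘ fun u => t₀ + u * (t₁ - t₀)) (Set.Icc 0 1) := fun x hx y hy hxy =>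
    hm (hmaps hx) (hmaps hy) (by
      have := mul_le_mul_of_nonneg_right hxy (sub_nonneg.2 ht)
      simpa using this)
  refine ⟨fun u => (γ (t₀ + u * (t₁ - t₀))).1, fun u => (γ (t₀ + u * (t₁ - t₀))).2,
    continuous_fst.comp_continuousOn hc', continuous_snd.comp_continuousOn hc',
    fun x hx y hy hxy => (hm' hx hy hxy).1, Or.inl fun x hx y hy hxy => (hm' hx hy hxy).2,
    by simp [h0], by simp [h0], by simp [h1], by simp [h1], fun u hu => hA _ (hmaps hu)⟩

theorem mem_covA (h : UpPath A (a, b) (c, e)) {x : ℝ} (hx : x ∈ Set.Icc a c) :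
    x ∈ PolygonalCurve.covA A b e :=
  ⟨a, c, h.monotonePath, hx⟩

end UpPath

theorem mem_covA_of_convex {A K : Set (ℝ × ℝ)} (hK : Convex ℝ K) (hKA : K ⊆ A) {a b c e x : ℝ}
    (hp : (a, b) ∈ K) (hq : (c, e) ∈ K) (hx : x ∈ Set.Icc a c) :
    x ∈ PolygonalCurve.covA A b e := by
  have hac : a ≤ c := hx.1.trans hx.2
  refine ⟨a, c, ⟨fun t => AffineMap.lineMap a c t, fun t => AffineMap.lineMap b e t,
    AffineMap.lineMap_continuous.continuousOn, AffineMap.lineMap_continuous.continuousOn,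
    fun s _ t _ hst => ?_, ?_, by simp, by simp, by simp, by simp, fun t ht => hKA ?_⟩, hx⟩
  · simp only [AffineMap.lineMap_apply_ring']
    nlinarith
  · rcases le_total b e with h | h
    · refine Or.inl fun s _ t _ hst => ?_
      simp only [AffineMap.lineMap_apply_ring']
      nlinarith
    · refine Or.inr fun s _ t _ hst => ?_
      simp only [AffineMap.lineMap_apply_ring']
      nlinarith
  · have := hK.lineMap_mem hp hq ht
    rwa [show AffineMap.lineMap (a, b) (c, e) t =
      ((AffineMap.lineMap a c t : ℝ), (AffineMap.lineMap b e t : ℝ)) from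
      Prod.ext (AffineMap.fst_lineMap _ _ _) (AffineMap.snd_lineMap _ _ _)] at this

/-- A Fréchet matching of two subcurves is a monotone path in the free space diagram. -/
theorem upPath_of_frechetDist_le {d : ℕ} {P S : PolygonalCurve d} {δ s t s' t' : ℝ} (hδ : 0 ≤ δ)
    (hs : 0 ≤ s) (hst : s ≤ t) (ht : t ≤ 1) (hs' : 0 ≤ s') (hst' : s' ≤ t') (ht' : t' ≤ 1)
    (h : frechetDist (P.sub s t) (S.sub s' t') ≤ ENNReal.ofReal δ) :
    UpPath (S.freeSpace P δ) (s, s') (t, t') := by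
  obtain ⟨F, G, hF, hG, hFG, hd⟩ := exists_matching_of_frechetDist_le hδ
    (P.continuous_sub ⟨hs, hst.trans ht⟩ ⟨hs.trans hst, ht⟩)
    (S.continuous_sub ⟨hs', hst'.trans ht'⟩ ⟨hs'.trans hst', ht'⟩) h
  have h0 := hFG 0
  have h1 := hFG 1
  -- both coordinates are monotone and add up to `2 u`, hence they are 2-Lipschitz
  have hLip : ∀ H H' : I → I, Monotone H → Monotone H' →
      (∀ u, (H u : ℝ) + H' u = 2 * u) → Continuous fun u : I => (H u : ℝ) := by
    intro H H' hH hH' hHH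
    refine (LipschitzWith.of_le_add_mul 2 fun u v => ?_).continuous
    rcases le_total u v with huv | huv
    · have a1 : (H u : ℝ) ≤ H v := hH huv
      have a2 : 0 ≤ dist u v := dist_nonneg
      simp only [NNReal.coe_ofNat]
      linarith
    · have a1 : (H' v : ℝ) ≤ H' u := hH' huv
      have a2 : (u : ℝ) - v ≤ dist u v := by
        rw [Subtype.dist_eq, Real.dist_eq]
        exact le_abs_self _
      have a3 := hHH u
      have a4 := hHH v
      simp only [NNReal.coe_ofNat]
      linarith
  have cF := hLip F G hF hG hFG
  have cG := hLip G F hG hF fun u => by rw [add_comm]; exact hFG u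
  have hpath : UpPath {z | z.1 ∈ Set.Icc (0 : ℝ) 1 ∧ z.2 ∈ Set.Icc (0 : ℝ) 1 ∧
      dist (P.sub s t z.1) (S.sub s' t' z.2) ≤ δ} (0, 0) (1, 1) := by
    refine ⟨0, 1, fun u => ((F (Set.projIcc 0 1 zero_le_one u) : ℝ),
      (G (Set.projIcc 0 1 zero_le_one u) : ℝ)), zero_le_one, ?_, ?_, ?_, ?_, ?_⟩
    · exact ((cF.comp continuous_projIcc).prodMk (cG.comp continuous_projIcc)).continuousOn
    · intro u _ v _ huv
      exact ⟨hF (Set.monotone_projIcc _ huv), hG (Set.monotone_projIcc _ huv)⟩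
    · have a1 := (F 0).2.1
      have a2 := (G 0).2.1
      simp only [Set.Icc.coe_zero] at h0
      beta_reduce
      rw [Set.projIcc_left]
      refine Prod.ext ?_ ?_
      · change (F 0 : ℝ) = 0
        linarith
      · change (G 0 : ℝ) = 0
        linarith
    · have a1 := (F 1).2.2
      have a2 := (G 1).2.2
      simp only [Set.Icc.coe_one] at h1
      beta_reduce
      rw [Set.projIcc_right]
      refine Prod.ext ?_ ?_
      · change (F 1 : ℝ) = 1
        linarith
      · change (G 1 : ℝ) = 1
        linarith
    · intro u _
      exact ⟨(F _).2, (G _).2, hd _⟩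
  have key := hpath.map (B := S.freeSpace P δ)
    (φ := fun z => (s + z.1 * (t - s), s' + z.2 * (t' - s'))) (by fun_prop) ?_ ?_
  · simpa using key
  · intro z w hzw
    have b1 := mul_le_mul_of_nonneg_right hzw.1 (sub_nonneg.2 hst)
    have b2 := mul_le_mul_of_nonneg_right hzw.2 (sub_nonneg.2 hst')
    exact ⟨by simpa using b1, by simpa using b2⟩
  · rintro z ⟨hz1, hz2, hz⟩
    refine ⟨⟨?_, ?_⟩, ⟨?_, ?_⟩, by simpa [dist_eq_norm, PolygonalCurve.sub] using hz⟩ <;>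
      nlinarith [hz1.1, hz1.2, hz2.1, hz2.2]

/-- A monotone path from `a` to `c`, rescaled to a non-decreasing surjection of `[0,1]`. For `a = c`
the path is constant, and the identity does. -/
theorem exists_monotone_surjective_rescale {f : ℝ → ℝ} {a c : ℝ}
    (hc : ContinuousOn f (Set.Icc 0 1))
    (hm : MonotoneOn f (Set.Icc 0 1) ∨ AntitoneOn f (Set.Icc 0 1)) (h0 : f 0 = a) (h1 : f 1 = c) :
    ∃ F : I → I, Monotone F ∧ Function.Surjective F ∧ ∀ u : I, a + F u * (c - a) = f u := by
  have m0 : (0 : ℝ) ∈ Set.Icc (0 : ℝ) 1 := ⟨le_rfl, zero_le_one⟩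
  have m1 : (1 : ℝ) ∈ Set.Icc (0 : ℝ) 1 := ⟨zero_le_one, le_rfl⟩
  rcases eq_or_ne a c with rfl | hac
  · refine ⟨id, monotone_id, Function.surjective_id, fun u => ?_⟩
    rcases hm with hm | hm
    · have b1 := hm m0 u.2 u.2.1
      have b2 := hm u.2 m1 u.2.2
      rw [sub_self, mul_zero, add_zero]
      exact le_antisymm (h0 ▸ b1) (b2.trans_eq h1)
    · have b1 := hm m0 u.2 u.2.1
      have b2 := hm u.2 m1 u.2.2
      rw [sub_self, mul_zero, add_zero]
      exact le_antisymm (h1.symm.trans_le b2) (b1.trans_eq h0)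
  have hca : c - a ≠ 0 := sub_ne_zero.2 hac.symm
  have hF : ∀ u v : I, u ≤ v → (f u - a) / (c - a) ≤ (f v - a) / (c - a) := by
    intro u v huv
    rcases hm with hm | hm
    · have b := hm u.2 v.2 huv
      have hpos : a ≤ c := h0 ▸ h1 ▸ hm m0 m1 zero_le_one
      exact div_le_div_of_nonneg_right (by linarith) (by linarith)
    · have b := hm u.2 v.2 huv
      have hneg : c ≤ a := h0 ▸ h1 ▸ hm m0 m1 zero_le_one
      exact div_le_div_of_nonpos_of_le (by linarith) (by linarith)
  have e0 : (f (0 : I) - a) / (c - a) = 0 := by simp [h0]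
  have e1 : (f (1 : I) - a) / (c - a) = 1 := by simp [h1, hca]
  let F : I → I := fun u => ⟨(f u - a) / (c - a),
    e0 ▸ hF 0 u unitInterval.nonneg', e1 ▸ hF u 1 unitInterval.le_one'⟩
  have hFc : Continuous F := by
    have : Continuous fun u : I => f u := hc.comp_continuous continuous_subtype_val fun u => u.2
    exact Continuous.subtype_mk ((this.sub continuous_const).div_const _) _
  refine ⟨F, fun u v huv => hF u v huv, fun y => ?_, fun u => ?_⟩
  · refine mem_range_of_exists_le_of_exists_ge hFc ⟨0, ?_⟩ ⟨1, ?_⟩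
    · rw [show F 0 = 0 from Subtype.ext e0]; exact unitInterval.nonneg'
    · rw [show F 1 = 1 from Subtype.ext e1]; exact unitInterval.le_one'
  · change a + (f u - a) / (c - a) * (c - a) = f u
    field_simp
    ring

theorem covA_subset_cov {d : ℕ} {P S : PolygonalCurve d} {δ : ℝ} {A : Set (ℝ × ℝ)}
    (hA : A ⊆ S.freeSpace P δ) (b e : ℝ) :
    PolygonalCurve.covA A b e ⊆ P.cov (S.sub b e) δ := by
  rintro x ⟨a, c, ⟨f, g, hf, hg, hfm, hgm, rfl, rfl, rfl, rfl, hfg⟩, hx⟩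
  have m0 : (0 : ℝ) ∈ Set.Icc (0 : ℝ) 1 := ⟨le_rfl, zero_le_one⟩
  have m1 : (1 : ℝ) ∈ Set.Icc (0 : ℝ) 1 := ⟨zero_le_one, le_rfl⟩
  obtain ⟨F, hF, hF', hFe⟩ := exists_monotone_surjective_rescale hf (Or.inl hfm) rfl rfl
  obtain ⟨G, hG, hG', hGe⟩ := exists_monotone_surjective_rescale hg hgm rfl rfl
  refine ⟨f 0, f 1, (hA (hfg 0 m0)).1.1, hfm m0 m1 zero_le_one, (hA (hfg 1 m1)).1.2, ?_, hx⟩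
  refine frechetDist_le_of_forall hF hF' hG hG' fun t => ?_
  simp only [PolygonalCurve.sub]
  rw [hFe, hGe, edist_dist, dist_eq_norm]
  exact ENNReal.ofReal_le_ofReal (hA (hfg t t.2)).2.2

/-! ### Strips of a row of the free space diagram -/

theorem exists_lex_min {K : Set (ℝ × ℝ)} (hK : IsCompact K) (hne : K.Nonempty) {f g : ℝ × ℝ → ℝ}
    (hf : Continuous f) (hg : Continuous g) :
    ∃ p ∈ K, (∀ q ∈ K, f p ≤ f q) ∧ ∀ q ∈ K, f q = f p → g p ≤ g q := by
  obtain ⟨m, hm, hmin⟩ := hK.exists_isMinOn hne hf.continuousOn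
  obtain ⟨p, hp, hpmin⟩ := (hK.inter_right (isClosed_eq hf (continuous_const (y := f m)))
    ).exists_isMinOn ⟨m, hm, rfl⟩ hg.continuousOn
  have hpm : f p = f m := hp.2
  exact ⟨p, hp.1, fun q hq => hpm.trans_le (hmin hq), fun q hq hqp => hpmin ⟨hq, hqp.trans hpm⟩⟩

theorem Convex.exists_mem_snd_eq {K : Set (ℝ × ℝ)} (hK : Convex ℝ K) {p q : ℝ × ℝ} (hp : p ∈ K)
    (hq : q ∈ K) {h : ℝ} (hph : p.2 ≤ h) (hhq : h ≤ q.2) :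
    ∃ x ∈ Set.uIcc p.1 q.1, (x, h) ∈ K := by
  rcases (hph.trans hhq).eq_or_lt with heq | hlt
  · exact ⟨p.1, Set.left_mem_uIcc, by rwa [← le_antisymm hph (heq ▸ hhq)]⟩
  · have hd : 0 < q.2 - p.2 := sub_pos.2 hlt
    have ht : (h - p.2) / (q.2 - p.2) ∈ Set.Icc (0 : ℝ) 1 :=
      ⟨div_nonneg (by linarith) hd.le, (div_le_one hd).2 (by linarith)⟩
    refine ⟨AffineMap.lineMap p.1 q.1 ((h - p.2) / (q.2 - p.2)),
      (convex_uIcc _ _).lineMap_mem Set.left_mem_uIcc Set.right_mem_uIcc ht, ?_⟩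
    have := hK.lineMap_mem hp hq ht
    convert this using 1
    refine Prod.ext (AffineMap.fst_lineMap _ _ _).symm ?_
    change h = _
    rw [AffineMap.snd_lineMap, AffineMap.lineMap_apply_ring']
    field_simp
    ring

/-- The horizontal strip between the heights `ε < ε'` in the `j`-th row of the free space diagram;
no extremal point of `A` in that row lies strictly inside the strip. -/
structure IsStrip {d : ℕ} (S P : PolygonalCurve d) (A : Set (ℝ × ℝ)) (j : Fin S.numEdges)
    (ε ε' : ℝ) : Prop where
  lt : ε < ε'
  left_mem : ε ∈ Set.Icc (S.knot j.castSucc) (S.knot j.succ)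
  right_mem : ε' ∈ Set.Icc (S.knot j.castSucc) (S.knot j.succ)
  convex : ∀ i, Convex ℝ (A ∩ S.cell P j i)
  isCompact : ∀ i, IsCompact (A ∩ S.cell P j i)
  extremal : ∀ p ∈ S.extremalPoints P A j, p.2 ≤ ε ∨ ε' ≤ p.2
  fst_mem : ∀ p ∈ A, p.1 ∈ Set.Icc (0 : ℝ) 1

namespace IsStrip

open PolygonalCurve

variable {d : ℕ} {S P : PolygonalCurve d} {A : Set (ℝ × ℝ)} {j : Fin S.numEdges} {ε ε' : ℝ}

theorem mem_row (hs : IsStrip S P A j ε ε') {y : ℝ} (hy : y ∈ Set.Icc ε ε') :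
    y ∈ Set.Icc (S.knot j.castSucc) (S.knot j.succ) :=
  ⟨hs.left_mem.1.trans hy.1, hy.2.trans hs.right_mem.2⟩

theorem exists_cell (hs : IsStrip S P A j ε ε') {x y : ℝ} (hxy : (x, y) ∈ A)
    (hy : y ∈ Set.Icc ε ε') :
    ∃ i, x ∈ Set.Icc (P.knot i.castSucc) (P.knot i.succ) ∧ (x, y) ∈ A ∩ S.cell P j i := by
  obtain ⟨i, hi⟩ := P.exists_edge (hs.fst_mem _ hxy)
  exact ⟨i, hi, hxy, hi, hs.mem_row hy⟩

theorem exists_leftmost (hs : IsStrip S P A j ε ε') {i : Fin P.numEdges}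
    (hne : (A ∩ S.cell P j i).Nonempty) :
    ∃ p ∈ A ∩ S.cell P j i, (∀ q ∈ A ∩ S.cell P j i, p.1 ≤ q.1) ∧
      (∀ q ∈ A ∩ S.cell P j i, q.1 = p.1 → p.2 ≤ q.2) ∧ (p.2 ≤ ε ∨ ε' ≤ p.2) := by
  obtain ⟨p, hp, h1, h2⟩ := exists_lex_min (hs.isCompact i) hne continuous_fst continuous_snd
  exact ⟨p, hp, h1, h2, hs.extremal p (Set.mem_iUnion.2
    ⟨i, Or.inl (Or.inl (Or.inl ⟨hp, h1, Or.inl h2⟩))⟩)⟩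

theorem exists_leftmost_top (hs : IsStrip S P A j ε ε') {i : Fin P.numEdges}
    (hne : (A ∩ S.cell P j i).Nonempty) :
    ∃ p ∈ A ∩ S.cell P j i, (∀ q ∈ A ∩ S.cell P j i, p.1 ≤ q.1) ∧
      (∀ q ∈ A ∩ S.cell P j i, q.1 = p.1 → q.2 ≤ p.2) ∧ (p.2 ≤ ε ∨ ε' ≤ p.2) := by
  obtain ⟨p, hp, h1, h2⟩ := exists_lex_min (hs.isCompact i) hne continuous_fst continuous_snd.neg
  have h2' : ∀ q ∈ A ∩ S.cell P j i, q.1 = p.1 → q.2 ≤ p.2 := fun q hq hqp =>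
    neg_le_neg_iff.1 (h2 q hq hqp)
  exact ⟨p, hp, h1, h2', hs.extremal p (Set.mem_iUnion.2
    ⟨i, Or.inl (Or.inl (Or.inl ⟨hp, h1, Or.inr h2'⟩))⟩)⟩

theorem exists_rightmost (hs : IsStrip S P A j ε ε') {i : Fin P.numEdges}
    (hne : (A ∩ S.cell P j i).Nonempty) :
    ∃ p ∈ A ∩ S.cell P j i, (∀ q ∈ A ∩ S.cell P j i, q.1 ≤ p.1) ∧
      (∀ q ∈ A ∩ S.cell P j i, q.1 = p.1 → p.2 ≤ q.2) ∧ (p.2 ≤ ε ∨ ε' ≤ p.2) := by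
  obtain ⟨p, hp, h1, h2⟩ := exists_lex_min (hs.isCompact i) hne continuous_fst.neg continuous_snd
  have h1' : ∀ q ∈ A ∩ S.cell P j i, q.1 ≤ p.1 := fun q hq => neg_le_neg_iff.1 (h1 q hq)
  have h2' : ∀ q ∈ A ∩ S.cell P j i, q.1 = p.1 → p.2 ≤ q.2 := fun q hq hqp =>
    h2 q hq (congrArg Neg.neg hqp)
  exact ⟨p, hp, h1', h2', hs.extremal p (Set.mem_iUnion.2
    ⟨i, Or.inl (Or.inl (Or.inr ⟨hp, h1', Or.inl h2'⟩))⟩)⟩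

theorem exists_rightmost_top (hs : IsStrip S P A j ε ε') {i : Fin P.numEdges}
    (hne : (A ∩ S.cell P j i).Nonempty) :
    ∃ p ∈ A ∩ S.cell P j i, (∀ q ∈ A ∩ S.cell P j i, q.1 ≤ p.1) ∧
      (∀ q ∈ A ∩ S.cell P j i, q.1 = p.1 → q.2 ≤ p.2) ∧ (p.2 ≤ ε ∨ ε' ≤ p.2) := by
  obtain ⟨p, hp, h1, h2⟩ :=
    exists_lex_min (hs.isCompact i) hne continuous_fst.neg continuous_snd.neg
  have h1' : ∀ q ∈ A ∩ S.cell P j i, q.1 ≤ p.1 := fun q hq => neg_le_neg_iff.1 (h1 q hq)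
  have h2' : ∀ q ∈ A ∩ S.cell P j i, q.1 = p.1 → q.2 ≤ p.2 := fun q hq hqp =>
    neg_le_neg_iff.1 (h2 q hq (congrArg Neg.neg hqp))
  exact ⟨p, hp, h1', h2', hs.extremal p (Set.mem_iUnion.2
    ⟨i, Or.inl (Or.inl (Or.inr ⟨hp, h1', Or.inr h2'⟩))⟩)⟩

/-- A cell that contains a point of `A` strictly inside the strip meets both sides of the strip. -/
theorem exists_sections (hs : IsStrip S P A j ε ε') {i : Fin P.numEdges} {x y : ℝ}
    (hxy : (x, y) ∈ A ∩ S.cell P j i) (hy : y ∈ Set.Ioo ε ε') :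
    (∃ x₀, (x₀, ε) ∈ A ∩ S.cell P j i) ∧ ∃ x₁, (x₁, ε') ∈ A ∩ S.cell P j i := by
  constructor
  · obtain ⟨p, hp, h1, h2⟩ :=
      exists_lex_min (hs.isCompact i) ⟨_, hxy⟩ continuous_snd continuous_fst
    have hpe := hs.extremal p (Set.mem_iUnion.2 ⟨i, Or.inl (Or.inr ⟨hp, h1, Or.inl h2⟩)⟩)
    have hpy : p.2 ≤ y := h1 _ hxy
    obtain ⟨x₀, -, hx₀⟩ := (hs.convex i).exists_mem_snd_eq hp hxy
      (hpe.resolve_right fun h => by linarith [hy.2]) hy.1.le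
    exact ⟨x₀, hx₀⟩
  · obtain ⟨p, hp, h1, h2⟩ :=
      exists_lex_min (hs.isCompact i) ⟨_, hxy⟩ continuous_snd.neg continuous_fst
    have h1' : ∀ q ∈ A ∩ S.cell P j i, q.2 ≤ p.2 := fun q hq => neg_le_neg_iff.1 (h1 q hq)
    have hpe := hs.extremal p (Set.mem_iUnion.2 ⟨i, Or.inr ⟨hp, h1', Or.inl fun q hq hqp =>
      h2 q hq (congrArg Neg.neg hqp)⟩⟩)
    have hpy : y ≤ p.2 := h1' _ hxy
    obtain ⟨x₁, -, hx₁⟩ := (hs.convex i).exists_mem_snd_eq hxy hp hy.2.le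
      (hpe.resolve_left fun h => by linarith [hy.1])
    exact ⟨x₁, hx₁⟩

/-- In every cell, `A` extends to the left of each of its points in the strip at one of the two
sides of the strip. -/
theorem exists_left (hs : IsStrip S P A j ε ε') {i : Fin P.numEdges} {x y : ℝ}
    (hxy : (x, y) ∈ A ∩ S.cell P j i) (hy : y ∈ Set.Icc ε ε') :
    ∃ l ≤ x, (l, ε) ∈ A ∩ S.cell P j i ∨ (l, ε') ∈ A ∩ S.cell P j i := by
  obtain ⟨p, hp, h1, -, hpe⟩ := hs.exists_leftmost ⟨_, hxy⟩
  have hpx : p.1 ≤ x := h1 _ hxy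
  rcases hpe with h | h
  · obtain ⟨l, hl, hl'⟩ := (hs.convex i).exists_mem_snd_eq hp hxy h hy.1
    rw [Set.uIcc_of_le hpx] at hl
    exact ⟨l, hl.2, Or.inl hl'⟩
  · obtain ⟨l, hl, hl'⟩ := (hs.convex i).exists_mem_snd_eq hxy hp hy.2 h
    rw [Set.uIcc_of_ge hpx] at hl
    exact ⟨l, hl.2, Or.inr hl'⟩

theorem exists_right (hs : IsStrip S P A j ε ε') {i : Fin P.numEdges} {x y : ℝ}
    (hxy : (x, y) ∈ A ∩ S.cell P j i) (hy : y ∈ Set.Icc ε ε') :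
    ∃ r ≥ x, (r, ε) ∈ A ∩ S.cell P j i ∨ (r, ε') ∈ A ∩ S.cell P j i := by
  obtain ⟨p, hp, h1, -, hpe⟩ := hs.exists_rightmost ⟨_, hxy⟩
  have hpx : x ≤ p.1 := h1 _ hxy
  rcases hpe with h | h
  · obtain ⟨l, hl, hl'⟩ := (hs.convex i).exists_mem_snd_eq hp hxy h hy.1
    rw [Set.uIcc_of_ge hpx] at hl
    exact ⟨l, hl.1, Or.inl hl'⟩
  · obtain ⟨l, hl, hl'⟩ := (hs.convex i).exists_mem_snd_eq hxy hp hy.2 h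
    rw [Set.uIcc_of_le hpx] at hl
    exact ⟨l, hl.1, Or.inr hl'⟩

/-- If `A` meets both sides of the strip in a cell, then every point of `A` in the cell and in the
strip is covered by the strip, traversed upwards or downwards along a segment in the cell. -/
theorem mem_covA_of_sections (hs : IsStrip S P A j ε ε') {i : Fin P.numEdges} {x y x₀ x₁ : ℝ}
    (hxy : (x, y) ∈ A ∩ S.cell P j i) (hy : y ∈ Set.Icc ε ε') (h₀ : (x₀, ε) ∈ A ∩ S.cell P j i)
    (h₁ : (x₁, ε') ∈ A ∩ S.cell P j i) : x ∈ covA A ε ε' ∨ x ∈ covA A ε' ε := by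
  have cov := fun {a b c e : ℝ} => mem_covA_of_convex (a := a) (b := b) (c := c) (e := e) (x := x)
    (hs.convex i) Set.inter_subset_left
  obtain ⟨l, hlx, hl⟩ := hs.exists_left hxy hy
  obtain ⟨r, hrx, hr⟩ := hs.exists_right hxy hy
  rcases hl with hl | hl <;> rcases hr with hr | hr
  · rcases le_total x x₁ with h | h
    · exact Or.inl (cov hl h₁ ⟨hlx, h⟩)
    · exact Or.inr (cov h₁ hr ⟨h, hrx⟩)
  · exact Or.inl (cov hl hr ⟨hlx, hrx⟩)
  · exact Or.inr (cov hl hr ⟨hlx, hrx⟩)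
  · rcases le_total x x₀ with h | h
    · exact Or.inr (cov hl h₀ ⟨hlx, h⟩)
    · exact Or.inl (cov h₀ hr ⟨h, hrx⟩)

theorem mem_covA_of_mem_Ioo (hs : IsStrip S P A j ε ε') {x y : ℝ} (hxy : (x, y) ∈ A)
    (hy : y ∈ Set.Ioo ε ε') : x ∈ covA A ε ε' ∨ x ∈ covA A ε' ε := by
  obtain ⟨i, -, hi⟩ := hs.exists_cell hxy (Set.Ioo_subset_Icc_self hy)
  obtain ⟨⟨x₀, h₀⟩, x₁, h₁⟩ := hs.exists_sections hi hy
  exact hs.mem_covA_of_sections hi (Set.Ioo_subset_Icc_self hy) h₀ h₁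

/-- On the vertical line between two cells, `A` contains both sides of the strip as soon as it
contains a point strictly inside: the ends of its section with this line are extremal points. -/
theorem knot_mem (hs : IsStrip S P A j ε ε') {k : Fin (P.numEdges + 1)} {y : ℝ}
    (hky : (P.knot k, y) ∈ A) (hy : y ∈ Set.Ioo ε ε') :
    (P.knot k, ε) ∈ A ∧ (P.knot k, ε') ∈ A := by
  have key : ∀ (i : Fin P.numEdges) (p q : ℝ × ℝ), p ∈ A ∩ S.cell P j i → q ∈ A ∩ S.cell P j i →
      p.1 = P.knot k → q.1 = P.knot k → p.2 ≤ y → y ≤ q.2 → (p.2 ≤ ε ∨ ε' ≤ p.2) →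
      (q.2 ≤ ε ∨ ε' ≤ q.2) → (P.knot k, ε) ∈ A ∧ (P.knot k, ε') ∈ A := by
    intro i p q hp hq hpk hqk hpy hqy hpe hqe
    have hpe' : p.2 ≤ ε := hpe.resolve_right fun h => by linarith [hy.2]
    have hqe' : ε' ≤ q.2 := hqe.resolve_left fun h => by linarith [hy.1]
    obtain ⟨x₀, hx₀, h₀⟩ := (hs.convex i).exists_mem_snd_eq hp hq hpe' (hs.lt.le.trans hqe')
    obtain ⟨x₁, hx₁, h₁⟩ := (hs.convex i).exists_mem_snd_eq hp hq (hpe'.trans hs.lt.le) hqe'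
    rw [hpk, hqk, Set.uIcc_self, Set.mem_singleton_iff] at hx₀ hx₁
    exact ⟨hx₀ ▸ h₀.1, hx₁ ▸ h₁.1⟩
  have hrow := hs.mem_row (Set.Ioo_subset_Icc_self hy)
  rcases eq_or_ne k 0 with rfl | hk
  · have hmem : (P.knot 0, y) ∈ A ∩ S.cell P j ⟨0, P.numEdges_pos⟩ :=
      ⟨hky, ⟨le_rfl, (P.knot_castSucc_lt ⟨0, P.numEdges_pos⟩).le⟩, hrow⟩
    obtain ⟨p, hp, hpl, hpb, hpe⟩ := hs.exists_leftmost ⟨_, hmem⟩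
    obtain ⟨q, hq, hql, hqb, hqe⟩ := hs.exists_leftmost_top ⟨_, hmem⟩
    have hp1 : p.1 = P.knot 0 := le_antisymm (hpl _ hmem) hp.2.1.1
    have hq1 : q.1 = P.knot 0 := le_antisymm (hql _ hmem) hq.2.1.1
    exact key _ p q hp hq hp1 hq1 (hpb _ hmem hp1.symm) (hqb _ hmem hq1.symm) hpe hqe
  · obtain ⟨i, rfl⟩ := Fin.exists_succ_eq.2 hk
    have hmem : (P.knot i.succ, y) ∈ A ∩ S.cell P j i :=
      ⟨hky, ⟨(P.knot_castSucc_lt _).le, le_rfl⟩, hrow⟩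
    obtain ⟨p, hp, hpl, hpb, hpe⟩ := hs.exists_rightmost ⟨_, hmem⟩
    obtain ⟨q, hq, hql, hqb, hqe⟩ := hs.exists_rightmost_top ⟨_, hmem⟩
    have hp1 : p.1 = P.knot i.succ := le_antisymm hp.2.1.2 (hpl _ hmem)
    have hq1 : q.1 = P.knot i.succ := le_antisymm hq.2.1.2 (hql _ hmem)
    exact key _ p q hp hq hp1 hq1 (hpb _ hmem hp1.symm) (hqb _ hmem hq1.symm) hpe hqe

theorem eq_or_eq_of_knot_mem {i : Fin P.numEdges} {k : Fin (P.numEdges + 1)}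
    (h : P.knot k ∈ Set.Icc (P.knot i.castSucc) (P.knot i.succ)) :
    k = i.castSucc ∨ k = i.succ := by
  have h1 := P.knot_strictMono.le_iff_le.1 h.1
  have h2 := P.knot_strictMono.le_iff_le.1 h.2
  rw [Fin.le_def] at h1 h2
  simp only [Fin.ext_iff, Fin.val_castSucc, Fin.val_succ] at *
  omega

/-- A horizontal segment lies in `A` if its end points and its crossings with the vertical lines
between cells do. -/
theorem upPath_horizontal (hs : IsStrip S P A j ε ε') {h p q : ℝ} (hh : h ∈ Set.Icc ε ε')
    (hpq : p ≤ q) (hp : (p, h) ∈ A) (hq : (q, h) ∈ A)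
    (hk : ∀ k, P.knot k ∈ Set.Icc p q → (P.knot k, h) ∈ A) : UpPath A (p, h) (q, h) := by
  refine UpPath.of_horizontal hpq fun x hx => ?_
  obtain ⟨i, hi⟩ := P.exists_edge (x := x)
    ⟨(hs.fst_mem _ hp).1.trans hx.1, hx.2.trans (hs.fst_mem _ hq).2⟩
  have hl : ∃ l ≤ x, (l, h) ∈ A ∩ S.cell P j i := by
    rcases le_total p (P.knot i.castSucc) with hle | hle
    · exact ⟨_, hi.1, hk _ ⟨hle, hi.1.trans hx.2⟩, ⟨le_rfl, hi.1.trans hi.2⟩, hs.mem_row hh⟩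
    · exact ⟨p, hx.1, hp, ⟨hle, hx.1.trans hi.2⟩, hs.mem_row hh⟩
  have hr : ∃ r ≥ x, (r, h) ∈ A ∩ S.cell P j i := by
    rcases le_total (P.knot i.succ) q with hle | hle
    · exact ⟨_, hi.2, hk _ ⟨hx.1.trans hi.2, hle⟩, ⟨hi.1.trans hi.2, le_rfl⟩, hs.mem_row hh⟩
    · exact ⟨q, hx.2, hq, ⟨hi.1.trans hx.2, hle⟩, hs.mem_row hh⟩
  obtain ⟨l, hlx, hl⟩ := hl
  obtain ⟨r, hrx, hr⟩ := hr
  have hconv : Convex ℝ {z : ℝ | (z, h) ∈ A ∩ S.cell P j i} := fun z hz w hw a b ha hb hab => by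
    have := hs.convex i hz hw ha hb hab
    simpa [← add_mul, hab] using this
  exact (hconv.ordConnected.out hl hr ⟨hlx, hrx⟩).1

/-- The beginning of a path can be moved to one of the two sides of the strip it starts in, without
covering less. -/
theorem exists_upPath_start (hs : IsStrip S P A j ε ε') {a y₀ x : ℝ} (hy₀ : y₀ ∈ Set.Icc ε ε')
    (h : UpPath A (a, y₀) (x, ε')) :
    ∃ a' ≤ a, UpPath A (a', ε) (x, ε') ∨ UpPath A (a', ε') (x, ε') := by
  rcases hy₀.1.eq_or_lt with rfl | hlt
  · exact ⟨a, le_rfl, Or.inl h⟩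
  obtain ⟨i, hai, hi⟩ := hs.exists_cell h.left_mem hy₀
  obtain ⟨l, hla, hl | hl⟩ := hs.exists_left hi hy₀
  · exact ⟨l, hla, Or.inl ((UpPath.of_convex (hs.convex i) Set.inter_subset_left hl hi
      ⟨hla, hy₀.1⟩).trans h)⟩
  · refine ⟨l, hla, Or.inr (hs.upPath_horizontal ⟨hs.lt.le, le_rfl⟩ (hla.trans h.le.1) hl.1
      h.right_mem fun k hk => ?_)⟩
    rcases le_or_gt a (P.knot k) with hak | hak
    · obtain ⟨y, h1, h2⟩ := h.exists_split_fst ⟨hak, hk.2⟩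
      have hy1 : y₀ ≤ y := h1.le.2
      have hy2 : y ≤ ε' := h2.le.2
      rcases hy2.eq_or_lt with rfl | hlt'
      · exact h1.right_mem
      · exact (hs.knot_mem h1.right_mem ⟨hlt.trans_le hy1, hlt'⟩).2
    -- a vertical line between `l` and `a` is the left boundary of their cell and passes through `l`
    · have hlk : P.knot i.castSucc ≤ l := hl.2.1.1
      rcases eq_or_eq_of_knot_mem (i := i) (k := k) ⟨hlk.trans hk.1, hak.le.trans hai.2⟩ with
        rfl | rfl
      · rw [le_antisymm hlk hk.1]
        exact hl.1
      · exact absurd hai.2 (not_le.2 hak)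

/-- The end of a path can be moved to one of the two sides of the strip it ends in, without
covering less. -/
theorem exists_upPath_end (hs : IsStrip S P A j ε ε') {c y₁ x : ℝ} (hy₁ : y₁ ∈ Set.Icc ε ε')
    (h : UpPath A (x, ε) (c, y₁)) :
    ∃ c' ≥ c, UpPath A (x, ε) (c', ε) ∨ UpPath A (x, ε) (c', ε') := by
  rcases hy₁.2.eq_or_lt with rfl | hlt
  · exact ⟨c, le_rfl, Or.inr h⟩
  obtain ⟨i, hci, hi⟩ := hs.exists_cell h.right_mem hy₁
  obtain ⟨r, hrc, hr | hr⟩ := hs.exists_right hi hy₁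
  · refine ⟨r, hrc, Or.inl (hs.upPath_horizontal ⟨le_rfl, hs.lt.le⟩ (le_trans h.le.1 hrc)
      h.left_mem hr.1 fun k hk => ?_)⟩
    rcases le_or_gt (P.knot k) c with hkc | hkc
    · obtain ⟨y, h1, h2⟩ := h.exists_split_fst ⟨hk.1, hkc⟩
      have hy1 : ε ≤ y := h1.le.2
      have hy2 : y ≤ y₁ := h2.le.2
      rcases hy1.eq_or_lt with rfl | hlt'
      · exact h1.right_mem
      · exact (hs.knot_mem h1.right_mem ⟨hlt', hy2.trans_lt hlt⟩).1
    · have hrk : r ≤ P.knot i.succ := hr.2.1.2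
      rcases eq_or_eq_of_knot_mem (i := i) (k := k) ⟨hci.1.trans hkc.le, hk.2.trans hrk⟩ with
        rfl | rfl
      · exact absurd hci.1 (not_le.2 hkc)
      · rw [le_antisymm hk.2 hrk]
        exact hr.1
  · exact ⟨r, hrc, Or.inr (h.trans (UpPath.of_convex (hs.convex i) Set.inter_subset_left hi hr
      ⟨hrc, hy₁.2⟩))⟩

/-- A path that starts on the lower side of the strip may run through cells in which `A` does not
enter the strip. If it reaches the abscissa `x'` of some point of `A` strictly inside the strip,
then it can be continued from there to the upper side. -/
theorem mem_covA_of_upPath_left (hs : IsStrip S P A j ε ε') {x x' y' y₁ : ℝ}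
    (h : UpPath A (x, ε) (x', y')) (hy' : y' ≤ ε') (hA : (x', y₁) ∈ A) (hy₁ : y₁ ∈ Set.Ioo ε ε') :
    x ∈ covA A ε ε' ∨ x ∈ covA A ε' ε := by
  obtain ⟨i, hxi, hi⟩ := hs.exists_cell hA (Set.Ioo_subset_Icc_self hy₁)
  obtain ⟨⟨x₀, h₀⟩, x₁, h₁⟩ := hs.exists_sections hi hy₁
  have hxx' : x ≤ x' := h.le.1
  rcases le_total (P.knot i.castSucc) x with hle | hle
  · exact hs.mem_covA_of_sections
      ⟨h.left_mem, ⟨hle, hxx'.trans hxi.2⟩, hs.left_mem⟩ ⟨le_rfl, hs.lt.le⟩ h₀ h₁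
  · obtain ⟨y, g1, g2⟩ := h.exists_split_fst ⟨hle, hxi.1⟩
    have hy : y ∈ Set.Icc ε ε' := ⟨g1.le.2, le_trans g2.le.2 hy'⟩
    have hk : (P.knot i.castSucc, y) ∈ A ∩ S.cell P j i :=
      ⟨g1.right_mem, ⟨le_rfl, (P.knot_castSucc_lt i).le⟩, hs.mem_row hy⟩
    exact Or.inl ((g1.trans (UpPath.of_convex (hs.convex i) Set.inter_subset_left hk h₁
      ⟨h₁.2.1.1, hy.2⟩)).mem_covA ⟨le_rfl, hle.trans h₁.2.1.1⟩)

theorem mem_covA_of_upPath_right (hs : IsStrip S P A j ε ε') {x x' y' y₁ : ℝ}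
    (h : UpPath A (x', y') (x, ε')) (hy' : ε ≤ y') (hA : (x', y₁) ∈ A) (hy₁ : y₁ ∈ Set.Ioo ε ε') :
    x ∈ covA A ε ε' ∨ x ∈ covA A ε' ε := by
  obtain ⟨i, hxi, hi⟩ := hs.exists_cell hA (Set.Ioo_subset_Icc_self hy₁)
  obtain ⟨⟨x₀, h₀⟩, x₁, h₁⟩ := hs.exists_sections hi hy₁
  have hxx' : x' ≤ x := h.le.1
  rcases le_total x (P.knot i.succ) with hle | hle
  · exact hs.mem_covA_of_sections
      ⟨h.right_mem, ⟨hxi.1.trans hxx', hle⟩, hs.right_mem⟩ ⟨hs.lt.le, le_rfl⟩ h₀ h₁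
  · obtain ⟨y, g1, g2⟩ := h.exists_split_fst ⟨hxi.2, hle⟩
    have hy : y ∈ Set.Icc ε ε' := ⟨le_trans hy' g1.le.2, g2.le.2⟩
    have hk : (P.knot i.succ, y) ∈ A ∩ S.cell P j i :=
      ⟨g1.right_mem, ⟨(P.knot_castSucc_lt i).le, le_rfl⟩, hs.mem_row hy⟩
    exact Or.inl (((UpPath.of_convex (hs.convex i) Set.inter_subset_left h₀ hk
      ⟨h₀.2.1.2, hy.1⟩).trans g2).mem_covA ⟨le_trans h₀.2.1.2 hle, le_rfl⟩)

/-- A path inside the strip that is not horizontal is covered by the strip, traversed upwards or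
downwards. -/
theorem mem_covA_of_upPath (hs : IsStrip S P A j ε ε') {a y₀ c y₁ x : ℝ}
    (h : UpPath A (a, y₀) (c, y₁)) (hy₀ : ε ≤ y₀) (hlt : y₀ < y₁) (hy₁ : y₁ ≤ ε')
    (hx : x ∈ Set.Icc a c) : x ∈ covA A ε ε' ∨ x ∈ covA A ε' ε := by
  obtain ⟨y, g1, g2⟩ := h.exists_split_fst hx
  have k1 : y₀ ≤ y := g1.le.2
  have k2 : y ≤ y₁ := g2.le.2
  rcases (hy₀.trans k1).eq_or_lt with rfl | hl
  · obtain ⟨z, g3, -⟩ := g2.exists_split_snd (y := (ε + y₁) / 2) (by linarith) (by linarith)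
    exact hs.mem_covA_of_upPath_left g3 (by linarith) g3.right_mem
      ⟨by linarith, by linarith⟩
  rcases (k2.trans hy₁).eq_or_lt with rfl | hr
  · obtain ⟨z, -, g3⟩ := g1.exists_split_snd (y := (y₀ + y) / 2) (by linarith) (by linarith)
    exact hs.mem_covA_of_upPath_right g3 (by linarith) g3.left_mem
      ⟨by linarith, by linarith⟩
  exact hs.mem_covA_of_mem_Ioo g1.right_mem ⟨hl, hr⟩

end IsStrip

/-! ### Neighbouring values of `E` and the candidates -/

/-- `ε < ε'` are neighbours in the sorted set `T`. -/
def IsConsecutive (T : Finset ℝ) (ε ε' : ℝ) : Prop :=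
  ε ∈ T ∧ ε' ∈ T ∧ ε < ε' ∧ ∀ x ∈ T, x ≤ ε ∨ ε' ≤ x

theorem exists_isConsecutive_of_lt {T : Finset ℝ} {a b y : ℝ} (ha : a ∈ T) (hb : b ∈ T)
    (hay : a ≤ y) (hyb : y < b) : ∃ ε ε', IsConsecutive T ε ε' ∧ ε ≤ y ∧ y < ε' := by
  obtain ⟨ε, hε, hmax⟩ := (T.filter (· ≤ y)).exists_maximal ⟨a, by simp [ha, hay]⟩
  obtain ⟨ε', hε', hmin⟩ := (T.filter (y < ·)).exists_minimal ⟨b, by simp [hb, hyb]⟩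
  simp only [Finset.mem_filter] at hε hε' hmax hmin
  refine ⟨ε, ε', ⟨hε.1, hε'.1, hε.2.trans_lt hε'.2, fun x hx => ?_⟩, hε.2, hε'.2⟩
  rcases le_or_gt x y with h | h
  · exact Or.inl ((le_total x ε).elim id fun h' => hmax ⟨hx, h⟩ h')
  · exact Or.inr ((le_total ε' x).elim id fun h' => hmin ⟨hx, h⟩ h')

theorem exists_isConsecutive_of_gt {T : Finset ℝ} {a b y : ℝ} (ha : a ∈ T) (hb : b ∈ T)
    (hay : a < y) (hyb : y ≤ b) : ∃ ε ε', IsConsecutive T ε ε' ∧ ε < y ∧ y ≤ ε' := by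
  obtain ⟨ε, hε, hmax⟩ := (T.filter (· < y)).exists_maximal ⟨a, by simp [ha, hay]⟩
  obtain ⟨ε', hε', hmin⟩ := (T.filter (y ≤ ·)).exists_minimal ⟨b, by simp [hb, hyb]⟩
  simp only [Finset.mem_filter] at hε hε' hmax hmin
  refine ⟨ε, ε', ⟨hε.1, hε'.1, hε.2.trans_le hε'.2, fun x hx => ?_⟩, hε.2, hε'.2⟩
  rcases lt_or_ge x y with h | h
  · exact Or.inl ((le_total x ε).elim id fun h' => hmax ⟨hx, h⟩ h')
  · exact Or.inr ((le_total ε' x).elim id fun h' => hmin ⟨hx, h⟩ h')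

namespace PolygonalCurve

variable {d : ℕ} {S P : PolygonalCurve d} {A : Set (ℝ × ℝ)} {α δ Δ : ℝ} {ℓ : ℕ}
  {E : Fin S.numEdges → Finset ℝ}

theorem isCompact_cell (S P : PolygonalCurve d) (j : Fin S.numEdges) (i : Fin P.numEdges) :
    IsCompact (S.cell P j i) :=
  isCompact_Icc.prod isCompact_Icc

theorem IsApproxFreeSpace.inter_cell_eq (hA : S.IsApproxFreeSpace α δ P A) (hcl : IsClosed A)
    (j : Fin S.numEdges) (i : Fin P.numEdges) :
    A ∩ S.cell P j i = closure (A ∩ interior (S.cell P j i)) := by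
  have hC := (S.isCompact_cell P j i).isClosed
  apply Set.Subset.antisymm
  · rintro p ⟨hpA, hpC⟩
    by_cases hp : p ∈ interior (S.cell P j i)
    · exact subset_closure ⟨hpA, hp⟩
    · exact (hA.mem_iff_of_mem_frontier j i p (by rw [hC.frontier_eq]; exact ⟨hpC, hp⟩)).1 hpA
        j i hpC
  · exact closure_minimal (Set.inter_subset_inter_right _ interior_subset) (hcl.inter hC)

theorem IsApproxFreeSpace.convex_inter_cell (hA : S.IsApproxFreeSpace α δ P A)
    (hcl : IsClosed A) (j : Fin S.numEdges) (i : Fin P.numEdges) :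
    Convex ℝ (A ∩ S.cell P j i) := by
  rw [hA.inter_cell_eq hcl]
  exact (hA.convex_interior j i).closure

theorem isStrip_of_isConsecutive (hA : S.IsApproxFreeSpace α δ P A) (hcl : IsClosed A)
    (hE : S.IsExtremalSuperset P A E) {j : Fin S.numEdges} {ε ε' : ℝ}
    (h : IsConsecutive (E j) ε ε') : IsStrip S P A j ε ε' where
  lt := h.2.2.1
  left_mem := (hE j).2 h.1
  right_mem := (hE j).2 h.2.1
  convex := hA.convex_inter_cell hcl j
  isCompact i := (S.isCompact_cell P j i).inter_left hcl
  extremal p hp := h.2.2.2 p.2 ((hE j).1 ⟨p, hp, rfl⟩)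
  fst_mem _ hp := (hA.subset_freeSpace hp).1

theorem exists_dist_lt_of_frechetDist_le (hΔ : 0 < Δ)
    (h : frechetDist S.toFun P.toFun ≤ ENNReal.ofReal (2 * Δ)) {y : ℝ}
    (hy : y ∈ Set.Icc (0 : ℝ) 1) :
    ∃ x ∈ Set.Icc (0 : ℝ) 1, dist (S.toFun y) (P.toFun x) < 4 * Δ := by
  obtain ⟨f, g, -, hf, -, -, hfg⟩ := exists_of_frechetDist_lt
    (lt_of_le_of_lt h ((ENNReal.ofReal_lt_ofReal_iff (by linarith)).2
      (show 2 * Δ < 3 * Δ by linarith)))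
  obtain ⟨t, ht⟩ := hf ⟨y, hy⟩
  have := hfg t
  rw [ht, edist_dist, ENNReal.ofReal_le_ofReal_iff (by linarith)] at this
  exact ⟨g t, (g t).2, this.trans_lt (by linarith)⟩

/-- As every point of `S` is close to `P`, the free space reaches both ends of each row. -/
theorem knot_mem_extremalSuperset (hΔ : 0 < Δ)
    (h : frechetDist S.toFun P.toFun ≤ ENNReal.ofReal (2 * Δ))
    (hA : S.IsApproxFreeSpace α (4 * Δ) P A) (hcl : IsClosed A)
    (hE : S.IsExtremalSuperset P A E) (j : Fin S.numEdges) :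
    S.knot j.castSucc ∈ E j ∧ S.knot j.succ ∈ E j := by
  have key : ∀ y ∈ Set.Icc (S.knot j.castSucc) (S.knot j.succ), y ∈ Set.Icc (0 : ℝ) 1 →
      ∃ (i : Fin P.numEdges) (x : ℝ), (x, y) ∈ A ∩ S.cell P j i := fun y hy hy' => by
    obtain ⟨x, hx, hxy⟩ := exists_dist_lt_of_frechetDist_le hΔ h hy'
    obtain ⟨i, hi⟩ := P.exists_edge hx
    exact ⟨i, x, hA.freeSpace_subset ⟨hx, hy', by rw [← dist_eq_norm, dist_comm]; exact hxy.le⟩,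
      hi, hy⟩
  have hlt := (S.knot_castSucc_lt j).le
  constructor
  · obtain ⟨i, x, hx⟩ := key _ ⟨le_rfl, hlt⟩ (S.knot_mem _)
    obtain ⟨p, hp, h1, h2⟩ := exists_lex_min ((S.isCompact_cell P j i).inter_left hcl) ⟨_, hx⟩
      continuous_snd continuous_fst
    exact (hE j).1 ⟨p, Set.mem_iUnion.2 ⟨i, Or.inl (Or.inr ⟨hp, h1, Or.inl h2⟩)⟩,
      le_antisymm (h1 _ hx) hp.2.2.1⟩
  · obtain ⟨i, x, hx⟩ := key _ ⟨hlt, le_rfl⟩ (S.knot_mem _)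
    obtain ⟨p, hp, h1, h2⟩ := exists_lex_min ((S.isCompact_cell P j i).inter_left hcl) ⟨_, hx⟩
      continuous_snd.neg continuous_fst
    have h1' : ∀ q ∈ A ∩ S.cell P j i, q.2 ≤ p.2 := fun q hq => neg_le_neg_iff.1 (h1 q hq)
    exact (hE j).1 ⟨p, Set.mem_iUnion.2 ⟨i, Or.inr ⟨hp, h1', Or.inl fun q hq hqp =>
      h2 q hq (congrArg Neg.neg hqp)⟩⟩, le_antisymm hp.2.2.2 (h1' _ hx)⟩

theorem subComplexity_of_mem_edge {j : Fin S.numEdges} {b e : ℝ}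
    (hb : b ∈ Set.Icc (S.knot j.castSucc) (S.knot j.succ))
    (he : e ∈ Set.Icc (S.knot j.castSucc) (S.knot j.succ)) : S.subComplexity b e = 2 := by
  have : {i | S.knot i ∈ Set.Ioo (min b e) (max b e)} = ∅ := by
    refine Set.eq_empty_of_forall_notMem fun i hi => ?_
    have h1 : S.knot j.castSucc < S.knot i := (le_min hb.1 he.1).trans_lt hi.1
    have h2 : S.knot i < S.knot j.succ := hi.2.trans_le (max_le hb.2 he.2)
    rw [S.knot_strictMono.lt_iff_lt, Fin.lt_def] at h1 h2
    simp only [Fin.val_castSucc, Fin.val_succ] at h1 h2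
    omega
  rw [subComplexity, this, Set.ncard_empty]

theorem subComplexity_knot {a b : Fin (S.numEdges + 1)} (hab : a < b) :
    S.subComplexity (S.knot a) (S.knot b) = b - a + 1 := by
  have hle := (S.knot_strictMono hab).le
  have : {i | S.knot i ∈ Set.Ioo (min (S.knot a) (S.knot b)) (max (S.knot a) (S.knot b))} =
      Finset.Ioo a b := by
    ext i
    simp [min_eq_left hle, max_eq_right hle, S.knot_strictMono.lt_iff_lt]
  rw [subComplexity, this, Set.ncard_coe_finset, Fin.card_Ioo]
  have : (a : ℕ) < b := hab
  omega

theorem mem_candidates_castSucc (hℓ : 2 ≤ ℓ) (hE : S.IsExtremalSuperset P A E)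
    {j : Fin S.numEdges} {ε : ℝ} (hε : ε ∈ E j) :
    (S.knot j.castSucc, ε) ∈ S.candidates ℓ E :=
  ⟨Or.inr (Or.inl ⟨j, _, Or.inl rfl, ε, hε, Or.inl rfl⟩),
    (subComplexity_of_mem_edge ⟨le_rfl, (S.knot_castSucc_lt j).le⟩ ((hE j).2 hε)).trans_le hℓ⟩

theorem mem_candidates_succ (hℓ : 2 ≤ ℓ) (hE : S.IsExtremalSuperset P A E)
    {j : Fin S.numEdges} {ε : ℝ} (hε : ε ∈ E j) :
    (ε, S.knot j.succ) ∈ S.candidates ℓ E :=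
  ⟨Or.inr (Or.inl ⟨j, _, Or.inl rfl, ε, hε, Or.inr rfl⟩),
    (subComplexity_of_mem_edge ((hE j).2 hε) ⟨(S.knot_castSucc_lt j).le, le_rfl⟩).trans_le hℓ⟩

theorem mem_candidates_of_add_two_pow (hℓ : 2 ≤ ℓ) (hE : S.IsExtremalSuperset P A E)
    {j : Fin S.numEdges} {a b : Fin (E j).card} {m : ℕ} (hm : m ≤ Nat.log 2 (E j).card)
    (hab : (b : ℕ) = a + 2 ^ m) :
    ((E j).orderEmbOfFin rfl a, (E j).orderEmbOfFin rfl b) ∈ S.candidates ℓ E ∧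
      ((E j).orderEmbOfFin rfl b, (E j).orderEmbOfFin rfl a) ∈ S.candidates ℓ E := by
  have h1 := (hE j).2 ((E j).orderEmbOfFin_mem rfl a)
  have h2 := (hE j).2 ((E j).orderEmbOfFin_mem rfl b)
  exact ⟨⟨Or.inr (Or.inr ⟨j, _, Or.inl rfl, a, b, m, hm, hab, rfl⟩),
    (subComplexity_of_mem_edge h1 h2).trans_le hℓ⟩,
    ⟨Or.inr (Or.inr ⟨j, _, Or.inr rfl, a, b, m, hm, hab, rfl⟩),
    (subComplexity_of_mem_edge h2 h1).trans_le hℓ⟩⟩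

theorem exists_orderEmbOfFin_eq {T : Finset ℝ} {x : ℝ} (hx : x ∈ T) :
    ∃ a, T.orderEmbOfFin rfl a = x := by
  have : x ∈ Set.range (T.orderEmbOfFin rfl) := by rwa [Finset.range_orderEmbOfFin]
  exact this

theorem mem_candidates_of_isConsecutive (hℓ : 2 ≤ ℓ) (hE : S.IsExtremalSuperset P A E)
    {j : Fin S.numEdges} {ε ε' : ℝ} (h : IsConsecutive (E j) ε ε') :
    (ε, ε') ∈ S.candidates ℓ E ∧ (ε', ε) ∈ S.candidates ℓ E := by
  obtain ⟨a, rfl⟩ := exists_orderEmbOfFin_eq h.1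
  obtain ⟨b, rfl⟩ := exists_orderEmbOfFin_eq h.2.1
  have hab : a < b := ((E j).orderEmbOfFin rfl).lt_iff_lt.1 h.2.2.1
  have hab' : (a : ℕ) < b := hab
  refine mem_candidates_of_add_two_pow hℓ hE (m := 0) (Nat.zero_le _) ?_
  have := h.2.2.2 _ ((E j).orderEmbOfFin_mem rfl ⟨a + 1, by omega⟩)
  simp only [OrderEmbedding.le_iff_le, Fin.le_def] at this
  rw [pow_zero]
  omega

/-! ### Sets covered by few candidates -/

/-- The union of the `x`-ranges of all upward paths in `A` from height `b` to height `e`. -/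
def upCov (A : Set (ℝ × ℝ)) (b e : ℝ) : Set ℝ :=
  {x | ∃ a c, UpPath A (a, b) (c, e) ∧ x ∈ Set.Icc a c}

theorem upCov_subset_covA (b e : ℝ) : upCov A b e ⊆ covA A b e := by
  rintro x ⟨a, c, h, hx⟩
  exact h.mem_covA hx

theorem upCov_subset_union {b y e : ℝ} (hb : b ≤ y) (he : y ≤ e) :
    upCov A b e ⊆ upCov A b y ∪ upCov A y e := by
  rintro x ⟨a, c, h, hx⟩
  obtain ⟨z, h1, h2⟩ := h.exists_split_snd hb he
  rcases le_total x z with hz | hz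
  · exact Or.inl ⟨a, z, h1, hx.1, hz⟩
  · exact Or.inr ⟨z, c, h2, hz, hx.2⟩

theorem _root_.IsStrip.upCov_subset_start {j : Fin S.numEdges} {ε ε' b e : ℝ}
    (hs : IsStrip S P A j ε ε') (hb : b ∈ Set.Icc ε ε') (he : ε' ≤ e) :
    upCov A b e ⊆ upCov A ε e ∪ upCov A ε' e := by
  rintro x ⟨a, c, h, hx⟩
  obtain ⟨z, h1, h2⟩ := h.exists_split_snd hb.2 he
  obtain ⟨a', ha', h3 | h3⟩ := hs.exists_upPath_start hb h1
  · exact Or.inl ⟨a', c, h3.trans h2, ha'.trans hx.1, hx.2⟩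
  · exact Or.inr ⟨a', c, h3.trans h2, ha'.trans hx.1, hx.2⟩

theorem _root_.IsStrip.upCov_subset_end {j : Fin S.numEdges} {ε ε' b e : ℝ}
    (hs : IsStrip S P A j ε ε') (he : e ∈ Set.Icc ε ε') (hb : b ≤ ε) :
    upCov A b e ⊆ upCov A b ε ∪ upCov A b ε' := by
  rintro x ⟨a, c, h, hx⟩
  obtain ⟨z, h1, h2⟩ := h.exists_split_snd hb he.1
  obtain ⟨c', hc', h3 | h3⟩ := hs.exists_upPath_end he h2
  · exact Or.inl ⟨a, c', h1.trans h3, hx.1, hx.2.trans hc'⟩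
  · exact Or.inr ⟨a, c', h1.trans h3, hx.1, hx.2.trans hc'⟩

/-- Two overlapping steps of length `2 ^ m`, where `2 ^ m ≤ b - a < 2 ^ (m + 1)`, lead from the
`a`-th to the `b`-th of finitely many increasing heights. -/
theorem exists_upCov_subset_of_two_pow {N : ℕ} {v : Fin N → ℝ} (hv : Monotone v) {a b : Fin N}
    (hab : a < b) : ∃ (a' b' : Fin N) (m : ℕ), 2 ^ m ≤ (b : ℕ) - a ∧ (a' : ℕ) = a + 2 ^ m ∧
      (b : ℕ) = b' + 2 ^ m ∧ ∀ A : Set (ℝ × ℝ),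
        upCov A (v a) (v b) ⊆ covA A (v a) (v a') ∪ covA A (v b') (v b) := by
  have hab' : (a : ℕ) < b := hab
  have h1 : 2 ^ Nat.log 2 ((b : ℕ) - a) ≤ (b : ℕ) - a := Nat.pow_log_le_self 2 (by omega)
  have h2 : (b : ℕ) - a < 2 ^ (Nat.log 2 ((b : ℕ) - a) + 1) :=
    Nat.lt_pow_succ_log_self one_lt_two _
  rw [pow_succ] at h2
  set w := 2 ^ Nat.log 2 ((b : ℕ) - a) with hw
  refine ⟨⟨a + w, by omega⟩, ⟨b - w, by omega⟩, _, h1, by simp [hw], by simp; omega,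
    fun A x hx => ?_⟩
  have hb : v ⟨b - w, by omega⟩ ≤ v ⟨a + w, by omega⟩ := hv (by
    rw [Fin.le_def]
    change (b : ℕ) - w ≤ a + w
    omega)
  have ha : v a ≤ v ⟨b - w, by omega⟩ := hv (by
    rw [Fin.le_def]
    change (a : ℕ) ≤ b - w
    omega)
  have ha' : v ⟨a + w, by omega⟩ ≤ v b := hv (by
    rw [Fin.le_def]
    change (a : ℕ) + w ≤ b
    omega)
  obtain ⟨x₀, x₁, h, hx⟩ := hx
  obtain ⟨z, g1, g2⟩ := h.exists_split_snd (ha.trans hb) ha'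
  rcases le_total x z with hz | hz
  · exact Or.inl (g1.mem_covA ⟨hx.1, hz⟩)
  · obtain ⟨z', g3, g4⟩ := g1.exists_split_snd ha hb
    exact Or.inr ((g4.trans g2).mem_covA ⟨le_trans g4.le.1 hz, hx.2⟩)

/-- The set `X` is contained in the union of the coverages of at most `n` candidates. -/
def Covered (S : PolygonalCurve d) (ℓ : ℕ) (E : Fin S.numEdges → Finset ℝ) (A : Set (ℝ × ℝ))
    (n : ℕ) (X : Set ℝ) : Prop :=
  ∃ F : Finset (ℝ × ℝ), (F : Set (ℝ × ℝ)) ⊆ S.candidates ℓ E ∧ F.card ≤ n ∧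
    X ⊆ ⋃ c ∈ F, covA A c.1 c.2

theorem Covered.mono {n m : ℕ} {X Y : Set ℝ} (h : S.Covered ℓ E A n X) (hnm : n ≤ m)
    (hYX : Y ⊆ X) : S.Covered ℓ E A m Y := by
  obtain ⟨F, h1, h2, h3⟩ := h
  exact ⟨F, h1, h2.trans hnm, hYX.trans h3⟩

theorem Covered.union {n m : ℕ} {X Y : Set ℝ} (hX : S.Covered ℓ E A n X)
    (hY : S.Covered ℓ E A m Y) : S.Covered ℓ E A (n + m) (X ∪ Y) := by
  classical
  obtain ⟨F, h1, h2, h3⟩ := hX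
  obtain ⟨G, g1, g2, g3⟩ := hY
  refine ⟨F ∪ G, by simp [h1, g1], (Finset.card_union_le _ _).trans (by omega), ?_⟩
  rw [Finset.set_biUnion_union]
  exact Set.union_subset_union h3 g3

theorem covered_empty : S.Covered ℓ E A 0 ∅ :=
  ⟨∅, by simp, by simp, by simp⟩

theorem covered_covA {b e : ℝ} (h : (b, e) ∈ S.candidates ℓ E) :
    S.Covered ℓ E A 1 (covA A b e) :=
  ⟨{(b, e)}, by simpa using h, by simp, by simp⟩

theorem covered_upCov {b e : ℝ} (h : (b, e) ∈ S.candidates ℓ E) :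
    S.Covered ℓ E A 1 (upCov A b e) :=
  (covered_covA h).mono le_rfl (upCov_subset_covA b e)

theorem covered_strip (hℓ : 2 ≤ ℓ) (hE : S.IsExtremalSuperset P A E)
    {j : Fin S.numEdges} {ε ε' : ℝ} (h : IsConsecutive (E j) ε ε') :
    S.Covered ℓ E A 2 (covA A ε ε' ∪ covA A ε' ε) :=
  (covered_covA (mem_candidates_of_isConsecutive hℓ hE h).1).union
    (covered_covA (mem_candidates_of_isConsecutive hℓ hE h).2)

/-- Two curves of Type (III) cover all upward paths between two distinct values of `E j`. -/
theorem covered_upCov_of_mem (hℓ : 2 ≤ ℓ) (hE : S.IsExtremalSuperset P A E) {j : Fin S.numEdges}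
    {h₀ h₁ : ℝ} (hh₀ : h₀ ∈ E j) (hh₁ : h₁ ∈ E j) (hlt : h₀ < h₁) :
    S.Covered ℓ E A 2 (upCov A h₀ h₁) := by
  obtain ⟨a, rfl⟩ := exists_orderEmbOfFin_eq hh₀
  obtain ⟨b, rfl⟩ := exists_orderEmbOfFin_eq hh₁
  obtain ⟨a', b', m, hm, ha', hb', hsub⟩ := exists_upCov_subset_of_two_pow
    ((E j).orderEmbOfFin rfl).monotone (((E j).orderEmbOfFin rfl).lt_iff_lt.1 hlt)
  have hm' : m ≤ Nat.log 2 (E j).card := by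
    refine Nat.le_log_of_pow_le one_lt_two (hm.trans ?_)
    have := b.2
    omega
  exact ((covered_covA (mem_candidates_of_add_two_pow hℓ hE hm' ha').1).union
    (covered_covA (mem_candidates_of_add_two_pow hℓ hE hm' hb').1)).mono le_rfl (hsub A)

/-- Two curves of Type (I) cover all upward paths between two distinct vertices of `S`. -/
theorem covered_upCov_knot {a b : Fin (S.numEdges + 1)} (hab : a < b) (hℓ : (b : ℕ) - a < ℓ) :
    S.Covered ℓ E A 2 (upCov A (S.knot a) (S.knot b)) := by
  obtain ⟨a', b', m, hm, ha', hb', hsub⟩ :=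
    exists_upCov_subset_of_two_pow S.knot_strictMono.monotone hab
  have hcand : ∀ p q : Fin (S.numEdges + 1), (q : ℕ) = p + 2 ^ m →
      (S.knot p, S.knot q) ∈ S.candidates ℓ E := fun p q hpq => by
    have hpos : 0 < 2 ^ m := by positivity
    refine ⟨Or.inl ⟨p, q, m, Nat.le_log_of_pow_le one_lt_two (by omega), hpq, rfl⟩, ?_⟩
    change S.subComplexity (S.knot p) (S.knot q) ≤ ℓ
    rw [subComplexity_knot (by rw [Fin.lt_def]; omega)]
    omega
  exact ((covered_covA (hcand _ _ ha')).union (covered_covA (hcand _ _ hb'))).mono le_rfl (hsub A)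

/-! ### Upward paths between two different heights -/

/-- Paths within one row. If the ends lie in the same strip or in adjacent strips, then these strips
cover everything; otherwise both ends are moved to the sides of their strips. -/
theorem covered_upCov_of_mem_edge (hℓ : 2 ≤ ℓ) (hE : S.IsExtremalSuperset P A E)
    {j : Fin S.numEdges} (hstrip : ∀ ε ε', IsConsecutive (E j) ε ε' → IsStrip S P A j ε ε')
    (hu : S.knot j.castSucc ∈ E j) (hv : S.knot j.succ ∈ E j) {b e : ℝ}
    (hb : S.knot j.castSucc ≤ b) (hbe : b < e) (he : e ≤ S.knot j.succ) :
    S.Covered ℓ E A 8 (upCov A b e) := by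
  obtain ⟨ε, ε', hε, hεb, hbε⟩ := exists_isConsecutive_of_lt hu hv hb (hbe.trans_le he)
  obtain ⟨η, η', hη, hηe, heη⟩ := exists_isConsecutive_of_gt hu hv (hb.trans_lt hbe) he
  have hsε := hstrip _ _ hε
  have hsη := hstrip _ _ hη
  rcases le_or_gt e ε' with h | h
  · refine (covered_strip hℓ hE hε).mono (by norm_num) ?_
    rintro x ⟨a, c, hp, hx⟩
    exact hsε.mem_covA_of_upPath hp hεb hbe h hx
  have hle : ε' ≤ η := (hη.2.2.2 _ hε.2.1).resolve_right fun h' => by linarith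
  rcases hle.eq_or_lt with rfl | hlt
  · refine ((covered_strip hℓ hE hε).union (covered_strip hℓ hE hη)).mono (by norm_num)
      ((upCov_subset_union hbε.le hηe.le).trans (Set.union_subset_union ?_ ?_))
    · rintro x ⟨a, c, hp, hx⟩
      exact hsε.mem_covA_of_upPath hp hεb hbε le_rfl hx
    · rintro x ⟨a, c, hp, hx⟩
      exact hsη.mem_covA_of_upPath hp le_rfl hηe heη hx
  · have lt1 := hε.2.2.1
    have lt2 := hη.2.2.1
    have k := fun {h₀ h₁ : ℝ} (m₀ : h₀ ∈ E j) (m₁ : h₁ ∈ E j) (hlt : h₀ < h₁) =>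
      covered_upCov_of_mem (A := A) hℓ hE m₀ m₁ hlt
    refine (((k hε.1 hη.1 (by linarith)).union (k hε.1 hη.2.1 (by linarith))).union
      ((k hε.2.1 hη.1 (by linarith)).union (k hε.2.1 hη.2.1 (by linarith)))).mono le_rfl ?_
    refine (hsε.upCov_subset_start ⟨hεb, hbε.le⟩ h.le).trans (Set.union_subset_union ?_ ?_)
    · exact hsη.upCov_subset_end ⟨hηe.le, heη⟩ (by linarith)
    · exact hsη.upCov_subset_end ⟨hηe.le, heη⟩ (by linarith)

theorem covered_upCov_to_succ (hℓ : 2 ≤ ℓ) (hE : S.IsExtremalSuperset P A E)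
    {j : Fin S.numEdges} (hstrip : ∀ ε ε', IsConsecutive (E j) ε ε' → IsStrip S P A j ε ε')
    (hu : S.knot j.castSucc ∈ E j) (hv : S.knot j.succ ∈ E j) {b : ℝ}
    (hb : S.knot j.castSucc ≤ b) (hb' : b < S.knot j.succ) :
    S.Covered ℓ E A 2 (upCov A b (S.knot j.succ)) := by
  obtain ⟨ε, ε', hε, hεb, hbε⟩ := exists_isConsecutive_of_lt hu hv hb hb'
  exact ((covered_upCov (mem_candidates_succ hℓ hE hε.1)).union
    (covered_upCov (mem_candidates_succ hℓ hE hε.2.1))).mono le_rfl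
    ((hstrip _ _ hε).upCov_subset_start ⟨hεb, hbε.le⟩ ((hE j).2 hε.2.1).2)

theorem covered_upCov_from_castSucc (hℓ : 2 ≤ ℓ) (hE : S.IsExtremalSuperset P A E)
    {j : Fin S.numEdges} (hstrip : ∀ ε ε', IsConsecutive (E j) ε ε' → IsStrip S P A j ε ε')
    (hu : S.knot j.castSucc ∈ E j) (hv : S.knot j.succ ∈ E j) {e : ℝ}
    (he : S.knot j.castSucc < e) (he' : e ≤ S.knot j.succ) :
    S.Covered ℓ E A 2 (upCov A (S.knot j.castSucc) e) := by
  obtain ⟨ε, ε', hε, hεe, heε⟩ := exists_isConsecutive_of_gt hu hv he he'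
  exact ((covered_upCov (mem_candidates_castSucc hℓ hE hε.1)).union
    (covered_upCov (mem_candidates_castSucc hℓ hE hε.2.1))).mono le_rfl
    ((hstrip _ _ hε).upCov_subset_end ⟨hεe.le, heε⟩ ((hE j).2 hε.1).1)

/-- Paths between two different heights. A path through vertices of `S` is cut at the first and at
the last of them. -/
theorem covered_upCov_of_lt (hℓ : 2 ≤ ℓ) (hE : S.IsExtremalSuperset P A E)
    (hstrip : ∀ j ε ε', IsConsecutive (E j) ε ε' → IsStrip S P A j ε ε')
    (hknot : ∀ j, S.knot j.castSucc ∈ E j ∧ S.knot j.succ ∈ E j) {b e : ℝ}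
    (hb : 0 ≤ b) (hbe : b < e) (he : e ≤ 1) (hcomp : S.subComplexity b e ≤ ℓ + 2) :
    S.Covered ℓ E A 8 (upCov A b e) := by
  classical
  set T := Finset.univ.filter fun k => S.knot k ∈ Set.Ioo b e with hT
  rcases T.eq_empty_or_nonempty with hempty | hne
  · obtain ⟨j, hj1, hj2⟩ := S.exists_edge_lt hb (hbe.trans_le he)
    refine covered_upCov_of_mem_edge hℓ hE (hstrip j) (hknot j).1 (hknot j).2 hj1 hbe ?_
    by_contra! hlt
    have : j.succ ∈ T := by simp [hT, hj2, hlt]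
    simp [hempty] at this
  set p := T.min' hne
  set q := T.max' hne
  have hp : S.knot p ∈ Set.Ioo b e := by
    have := T.min'_mem hne
    simpa only [hT, Finset.mem_filter, Finset.mem_univ, true_and] using this
  have hq : S.knot q ∈ Set.Ioo b e := by
    have := T.max'_mem hne
    simpa only [hT, Finset.mem_filter, Finset.mem_univ, true_and] using this
  have hpq : p ≤ q := T.min'_le _ (T.max'_mem hne)
  have hcard : (q : ℕ) - p < ℓ := by
    have hsub : Finset.Icc p q ⊆ T := fun i hi => by
      rw [Finset.mem_Icc] at hi
      simp only [hT, Finset.mem_filter, Finset.mem_univ, true_and]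
      exact ⟨hp.1.trans_le (S.knot_strictMono.monotone hi.1),
        (S.knot_strictMono.monotone hi.2).trans_lt hq.2⟩
    have h1 := Finset.card_le_card hsub
    rw [Fin.card_Icc] at h1
    have h2 : S.subComplexity b e = T.card + 2 := by
      rw [subComplexity, min_eq_left hbe.le, max_eq_right hbe.le, ← Set.ncard_coe_finset]
      congr 2
      ext i
      simp [hT]
    have : (p : ℕ) ≤ q := hpq
    omega
  have hp0 : p ≠ 0 := fun h => by
    have := hp.1
    rw [h, S.knot_zero] at this
    linarith
  have hql : q ≠ Fin.last _ := fun h => by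
    have := hq.2
    rw [h, S.knot_last] at this
    linarith
  obtain ⟨j₀, hj₀⟩ := Fin.exists_succ_eq.2 hp0
  obtain ⟨j₁, hj₁⟩ := Fin.exists_castSucc_eq.2 hql
  have hb' : S.knot j₀.castSucc ≤ b := by
    by_contra! hlt
    have hmem : j₀.castSucc ∈ T := by
      simp only [hT, Finset.mem_filter, Finset.mem_univ, true_and]
      exact ⟨hlt, (S.knot_castSucc_lt j₀).trans (hj₀ ▸ hp.2)⟩
    have hle : p ≤ j₀.castSucc := T.min'_le _ hmem
    rw [← hj₀] at hle
    exact absurd j₀.castSucc_lt_succ (not_lt.2 hle)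
  have he' : e ≤ S.knot j₁.succ := by
    by_contra! hlt
    have hmem : j₁.succ ∈ T := by
      simp only [hT, Finset.mem_filter, Finset.mem_univ, true_and]
      exact ⟨lt_trans (hj₁ ▸ hq.1) (S.knot_castSucc_lt j₁), hlt⟩
    have hle : j₁.succ ≤ q := T.le_max' _ hmem
    rw [← hj₁] at hle
    exact absurd j₁.castSucc_lt_succ (not_lt.2 hle)
  have c1 : S.Covered ℓ E A 2 (upCov A b (S.knot p)) := by
    rw [← hj₀]
    exact covered_upCov_to_succ hℓ hE (hstrip j₀) (hknot j₀).1 (hknot j₀).2 hb' (hj₀ ▸ hp.1)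
  have c3 : S.Covered ℓ E A 2 (upCov A (S.knot q) e) := by
    rw [← hj₁]
    exact covered_upCov_from_castSucc hℓ hE (hstrip j₁) (hknot j₁).1 (hknot j₁).2 (hj₁ ▸ hq.2) he'
  rcases hpq.eq_or_lt with heq | hlt
  · rw [← heq] at c3
    exact (c1.union c3).mono (by norm_num) (upCov_subset_union hp.1.le hp.2.le)
  · have c2 := covered_upCov_knot (A := A) (E := E) hlt hcard
    exact (c1.union (c2.union c3)).mono (by norm_num) ((upCov_subset_union hp.1.le hp.2.le).trans
      (Set.union_subset_union_right _
        (upCov_subset_union (S.knot_strictMono hlt).le hq.2.le)))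

/-! ### Horizontal paths -/

theorem exists_mem_Ioo_dist_lt {η η' y r : ℝ} {z : EuclideanSpace ℝ (Fin d)} (hη : η < η')
    (h0 : 0 ≤ η) (h1 : η' ≤ 1) (hy : y ∈ Set.Icc η η') (hd : dist z (S.toFun y) < r) :
    ∃ y₁ ∈ Set.Ioo η η', dist z (S.toFun y₁) < r := by
  have hsub : Set.Ioo η η' ⊆ Set.Icc 0 1 := fun w hw =>
    ⟨h0.trans hw.1.le, hw.2.le.trans h1⟩
  have hc : ContinuousWithinAt S.toFun (Set.Ioo η η') y :=
    (S.continuousOn y ⟨h0.trans hy.1, hy.2.trans h1⟩).mono hsub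
  have hne : (nhdsWithin y (Set.Ioo η η')).NeBot := by
    rw [← mem_closure_iff_nhdsWithin_neBot, closure_Ioo hη.ne]
    exact hy
  have hev := (continuousWithinAt_const.dist hc).eventually_lt_const hd
  obtain ⟨y₁, hy₁, hy₁'⟩ := (hev.and self_mem_nhdsWithin).exists
  exact ⟨y₁, hy₁', hy₁⟩

theorem eq_of_dist_eq_of_mem_edge {i : Fin P.numEdges} {x y r : ℝ}
    {o : EuclideanSpace ℝ (Fin d)} (hx : x ∈ Set.Icc (P.knot i.castSucc) (P.knot i.succ))
    (hy : y ∈ Set.Icc (P.knot i.castSucc) (P.knot i.succ)) (hrx : dist (P.toFun x) o = r)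
    (hry : dist (P.toFun y) o = r) (hrm : dist (P.toFun ((x + y) / 2)) o = r) :
    P.toFun x = P.toFun y := by
  have hm : P.toFun ((x + y) / 2) - o =
      (1 / 2 : ℝ) • ((P.toFun x - o) + (P.toFun y - o)) := by
    rw [P.toFun_eq_lineMap i _ hx, P.toFun_eq_lineMap i _ hy, P.toFun_eq_lineMap i ((x + y) / 2)
      ⟨by linarith [hx.1, hy.1], by linarith [hx.2, hy.2]⟩]
    simp only [AffineMap.lineMap_apply_module']
    have hk := sub_ne_zero.2 (P.knot_castSucc_lt i).ne'
    rw [show ((x + y) / 2 - P.knot i.castSucc) / (P.knot i.succ - P.knot i.castSucc) =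
      (1 / 2 : ℝ) * ((x - P.knot i.castSucc) / (P.knot i.succ - P.knot i.castSucc) +
        (y - P.knot i.castSucc) / (P.knot i.succ - P.knot i.castSucc)) by field_simp; ring]
    module
  rw [dist_eq_norm] at hrx hry hrm
  have hpar := parallelogram_law_with_norm ℝ (P.toFun x - o) (P.toFun y - o)
  rw [hm, norm_smul, Real.norm_of_nonneg (by norm_num)] at hrm
  have hsum : ‖(P.toFun x - o) + (P.toFun y - o)‖ = 2 * r := by linarith
  rw [hsum, hrx, hry, sub_sub_sub_cancel_right] at hpar
  have : ‖P.toFun x - P.toFun y‖ = 0 := by nlinarith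
  exact sub_eq_zero.1 (norm_eq_zero.1 this)

/-- A polygonal curve on a sphere is constant: it is constant on every edge by strict convexity, so
that its connected image is finite. -/
theorem eq_of_forall_dist_eq {a c r : ℝ} {o : EuclideanSpace ℝ (Fin d)} (ha : 0 ≤ a) (hc : c ≤ 1)
    (h : ∀ x ∈ Set.Icc a c, dist (P.toFun x) o = r) {x y : ℝ} (hx : x ∈ Set.Icc a c)
    (hy : y ∈ Set.Icc a c) : P.toFun x = P.toFun y := by
  have hsub : Set.Icc a c ⊆ Set.Icc 0 1 := Set.Icc_subset_Icc ha hc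
  have hfin : (P.toFun '' Set.Icc a c).Finite := by
    refine (Set.finite_iUnion fun i : Fin P.numEdges => Set.Subsingleton.finite (s := P.toFun ''
      (Set.Icc a c ∩ Set.Icc (P.knot i.castSucc) (P.knot i.succ))) ?_).subset ?_
    · rintro _ ⟨u, ⟨hu, hu'⟩, rfl⟩ _ ⟨v, ⟨hv, hv'⟩, rfl⟩
      exact eq_of_dist_eq_of_mem_edge hu' hv' (h u hu) (h v hv)
        (h _ ⟨by linarith [hu.1, hv.1], by linarith [hu.2, hv.2]⟩)
    · rintro _ ⟨u, hu, rfl⟩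
      obtain ⟨i, hi⟩ := P.exists_edge (hsub hu)
      exact Set.mem_iUnion.2 ⟨i, u, ⟨hu, hi⟩, rfl⟩
  have hpre := isPreconnected_Icc.image P.toFun (P.continuousOn.mono hsub)
  by_contra hxy
  exact hpre.infinite_of_nontrivial ⟨_, ⟨x, hx, rfl⟩, _, ⟨y, hy, rfl⟩, hxy⟩ hfin

/-- If the triangle inequality for `p, z, o` is tight, then `p` is determined by `z` and `o`. -/
theorem three_smul_eq_of_dist {p z o : EuclideanSpace ℝ (Fin d)} (hpz : dist p z ≤ Δ)
    (hzo : dist z o ≤ 3 * Δ) (hpo : 4 * Δ ≤ dist p o) : (3 : ℝ) • (p - z) = z - o := by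
  rw [dist_eq_norm] at *
  have e1 : ‖p - o‖ ^ 2 = ‖p - z‖ ^ 2 + 2 * inner ℝ (p - z) (z - o) + ‖z - o‖ ^ 2 := by
    rw [← norm_add_sq_real, sub_add_sub_cancel]
  have e2 : ‖(3 : ℝ) • (p - z) - (z - o)‖ ^ 2 =
      9 * ‖p - z‖ ^ 2 - 6 * inner ℝ (p - z) (z - o) + ‖z - o‖ ^ 2 := by
    rw [norm_sub_sq_real, norm_smul, inner_smul_left]
    norm_num
    ring
  have n1 := norm_nonneg (p - z)
  have n2 := norm_nonneg (z - o)
  have n3 : ‖p - o‖ ≤ ‖p - z‖ + ‖z - o‖ := norm_sub_le_norm_sub_add_norm_sub _ _ _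
  have a1 : ‖p - z‖ = Δ := by linarith
  have a2 : ‖z - o‖ = 3 * Δ := by linarith
  have a3 : ‖p - o‖ = 4 * Δ := by linarith
  rw [a1, a2, a3] at e1
  rw [a1, a2] at e2
  have : ‖(3 : ℝ) • (p - z) - (z - o)‖ ^ 2 = 0 := by rw [e2]; linarith
  exact sub_eq_zero.1 (norm_eq_zero.1 (pow_eq_zero_iff two_ne_zero |>.1 this))

/-- A horizontal path at a value `h` of `E j` which passes a point at distance less than `4 * Δ`
from `S h` is covered by the two strips next to `h`. -/
theorem mem_covA_of_horizontal {j : Fin S.numEdges} {ε h η s t x x' : ℝ}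
    (hsε : IsStrip S P A j ε h) (hsη : IsStrip S P A j h η) (hA : S.freeSpace P (4 * Δ) ⊆ A)
    (hp : UpPath A (s, h) (t, h)) (hs : 0 ≤ s) (ht : t ≤ 1) (hx : x ∈ Set.Icc s t)
    (hx' : x' ∈ Set.Icc s t) (hd : dist (P.toFun x') (S.toFun h) < 4 * Δ) :
    x ∈ (covA A ε h ∪ covA A h ε) ∪ (covA A h η ∪ covA A η h) := by
  have hx'1 : x' ∈ Set.Icc (0 : ℝ) 1 := ⟨hs.trans hx'.1, hx'.2.trans ht⟩
  have h0 := (S.knot_mem j.castSucc).1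
  have h1 := (S.knot_mem j.succ).2
  have hmem : ∀ y, 0 ≤ y → y ≤ 1 → dist (P.toFun x') (S.toFun y) < 4 * Δ → (x', y) ∈ A :=
    fun y hy0 hy1 hy => hA ⟨hx'1, ⟨hy0, hy1⟩, by rw [← dist_eq_norm]; exact hy.le⟩
  rcases le_total x x' with hle | hle
  · right
    obtain ⟨y₁, hy₁, hd₁⟩ := exists_mem_Ioo_dist_lt hsη.lt (h0.trans hsη.left_mem.1)
      (hsη.right_mem.2.trans h1) ⟨le_rfl, hsη.lt.le⟩ hd
    obtain ⟨w, g1, g2⟩ := hp.exists_split_fst hx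
    obtain rfl : w = h := le_antisymm g2.le.2 g1.le.2
    obtain ⟨w', g3, g4⟩ := g2.exists_split_fst ⟨hle, hx'.2⟩
    exact hsη.mem_covA_of_upPath_left g3 (le_trans g4.le.2 hsη.lt.le)
      (hmem y₁ (h0.trans (hsη.left_mem.1.trans hy₁.1.le))
        (hy₁.2.le.trans (hsη.right_mem.2.trans h1)) hd₁) hy₁
  · left
    obtain ⟨y₁, hy₁, hd₁⟩ := exists_mem_Ioo_dist_lt hsε.lt (h0.trans hsε.left_mem.1)
      (hsε.right_mem.2.trans h1) ⟨hsε.lt.le, le_rfl⟩ hd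
    obtain ⟨w, g1, g2⟩ := hp.exists_split_fst hx
    obtain rfl : w = h := le_antisymm g2.le.2 g1.le.2
    obtain ⟨w', g3, g4⟩ := g1.exists_split_fst ⟨hx'.1, hle⟩
    exact hsε.mem_covA_of_upPath_right g4 (le_trans hsε.lt.le g3.le.2)
      (hmem y₁ (h0.trans (hsε.left_mem.1.trans hy₁.1.le))
        (hy₁.2.le.trans (hsε.right_mem.2.trans h1)) hd₁) hy₁

/-- The subcurve of `S` found for `π` may be a single point `S h`, where `h` is a value of `E` in
the interior of an edge. Then `A` may be contained in the line at height `h` in some cells, so that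
no strip reaches them. A subcurve of `P` in the coverage of `π` which stays in such cells has
constant distance `4 * Δ` from `S h`. It is then a single point, the same for all such subcurves,
and it lies within distance less than `4 * Δ` of some other point of `S`, in a strip around which
it is covered. -/
theorem covered_cov_of_horizontal (hℓ : 2 ≤ ℓ) (hΔ : 0 < Δ) (hE : S.IsExtremalSuperset P A E)
    (hstrip : ∀ j ε ε', IsConsecutive (E j) ε ε' → IsStrip S P A j ε ε')
    (hknot : ∀ j, S.knot j.castSucc ∈ E j ∧ S.knot j.succ ∈ E j)
    (hA : S.freeSpace P (4 * Δ) ⊆ A)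
    (hSP : frechetDist S.toFun P.toFun ≤ ENNReal.ofReal (2 * Δ)) {h : ℝ}
    (hh : h ∈ Set.Icc (0 : ℝ) 1) {q : ℝ → EuclideanSpace ℝ (Fin d)}
    (hq : dist (q 0) (S.toFun h) ≤ 3 * Δ)
    (hpath : ∀ s t, 0 ≤ s → s ≤ t → t ≤ 1 → frechetDist (P.sub s t) q ≤ ENNReal.ofReal Δ →
      UpPath (S.freeSpace P (4 * Δ)) (s, h) (t, h)) :
    S.Covered ℓ E A 8 (P.cov q Δ) := by
  have hcov : P.cov q Δ ⊆ upCov A h h := by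
    rintro x ⟨s, t, hs, hst, ht, hd, hx⟩
    exact ⟨s, t, (hpath s t hs hst ht hd).mono hA, hx⟩
  obtain ⟨j, hj⟩ := S.exists_edge hh
  rcases hj.1.eq_or_lt with heq | hlt
  · rw [← heq] at hcov
    exact (covered_upCov (mem_candidates_castSucc hℓ hE (hknot j).1)).mono (by norm_num) hcov
  rcases hj.2.eq_or_lt with heq | hlt'
  · rw [heq] at hcov
    exact (covered_upCov (mem_candidates_succ hℓ hE (hknot j).2)).mono (by norm_num) hcov
  obtain ⟨η, η', hη, hηh, hhη⟩ := exists_isConsecutive_of_lt (hknot j).1 (hknot j).2 hj.1 hlt'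
  rcases hηh.eq_or_lt with rfl | hηh
  swap
  · refine (covered_strip hℓ hE hη).mono (by norm_num) (hcov.trans ?_)
    rintro x ⟨s, t, hp, hx⟩
    obtain ⟨w, g1, g2⟩ := hp.exists_split_fst hx
    obtain rfl : w = h := le_antisymm g2.le.2 g1.le.2
    exact (hstrip _ _ _ hη).mem_covA_of_mem_Ioo g1.right_mem ⟨hηh, hhη⟩
  obtain ⟨ε, ε', hε, hεh, hhε⟩ := exists_isConsecutive_of_gt (hknot j).1 (hknot j).2 hlt hj.2
  obtain rfl : ε' = η :=
    le_antisymm ((hε.2.2.2 η hη.1).resolve_left (not_le.2 hεh)) hhε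
  have hgood := (covered_strip (A := A) hℓ hE hε).union (covered_strip (A := A) hℓ hE hη)
  -- the points which only lie on subcurves at constant distance `4 * Δ` from `S ε'`
  let X : Set ℝ := {x | ∃ s t, 0 ≤ s ∧ s ≤ t ∧ t ≤ 1 ∧
    frechetDist (P.sub s t) q ≤ ENNReal.ofReal Δ ∧ x ∈ Set.Icc s t ∧
    ∀ z ∈ Set.Icc s t, dist (P.toFun z) (S.toFun ε') = 4 * Δ}
  have hX : S.Covered ℓ E A 2 X := by
    have hstart : ∀ s t, 0 ≤ s → s ≤ t → t ≤ 1 →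
        frechetDist (P.sub s t) q ≤ ENNReal.ofReal Δ →
        (∀ z ∈ Set.Icc s t, dist (P.toFun z) (S.toFun ε') = 4 * Δ) →
        (3 : ℝ) • (P.toFun s - q 0) = q 0 - S.toFun ε' := by
      intro s t hs hst ht hd hz
      have hd0 := (edist_zero_le_frechetDist _ _).trans hd
      rw [edist_dist, ENNReal.ofReal_le_ofReal_iff hΔ.le] at hd0
      exact three_smul_eq_of_dist (by simpa [sub] using hd0) hq (hz s ⟨le_rfl, hst⟩).ge
    rcases X.eq_empty_or_nonempty with hempty | ⟨-, s₀, t₀, hs₀, hst₀, ht₀, hd₀, -, hz₀⟩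
    · rw [hempty]
      exact covered_empty.mono (by norm_num) le_rfl
    obtain ⟨y, hy, hdy⟩ := exists_dist_lt_of_frechetDist_le (S := P) (P := S) hΔ
      (by rwa [frechetDist_comm]) (y := s₀) ⟨hs₀, hst₀.trans ht₀⟩
    obtain ⟨k, hk⟩ := S.exists_edge hy
    have hkne := S.knot_castSucc_lt k
    obtain ⟨θ, θ', hθ, hyθ⟩ : ∃ θ θ', IsConsecutive (E k) θ θ' ∧ y ∈ Set.Icc θ θ' := by
      rcases hk.2.eq_or_lt with heq | hlt
      · obtain ⟨θ, θ', hθ, h1, h2⟩ := exists_isConsecutive_of_gt (hknot k).1 (hknot k).2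
          (heq ▸ hkne) hk.2
        exact ⟨θ, θ', hθ, h1.le, h2⟩
      · obtain ⟨θ, θ', hθ, h1, h2⟩ := exists_isConsecutive_of_lt (hknot k).1 (hknot k).2 hk.1 hlt
        exact ⟨θ, θ', hθ, h1, h2.le⟩
    have hsθ := hstrip _ _ _ hθ
    have b0 := (S.knot_mem k.castSucc).1.trans hsθ.left_mem.1
    have b1 := hsθ.right_mem.2.trans (S.knot_mem k.succ).2
    obtain ⟨y₁, hy₁, hd₁⟩ := exists_mem_Ioo_dist_lt hsθ.lt b0 b1 hyθ hdy
    refine (covered_strip hℓ hE hθ).mono le_rfl ?_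
    rintro x ⟨s, t, hs, hst, ht, hd, hx, hz⟩
    have e1 : P.toFun x = P.toFun s := eq_of_forall_dist_eq hs ht hz hx ⟨le_rfl, hst⟩
    have e2 : P.toFun s = P.toFun s₀ := by
      have := (hstart s t hs hst ht hd hz).trans (hstart s₀ t₀ hs₀ hst₀ ht₀ hd₀ hz₀).symm
      exact sub_left_injective (smul_right_injective _ (three_ne_zero' ℝ) this)
    refine hsθ.mem_covA_of_mem_Ioo (hA ⟨⟨hs.trans hx.1, hx.2.trans ht⟩,
      ⟨b0.trans hy₁.1.le, hy₁.2.le.trans b1⟩, ?_⟩) hy₁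
    change ‖P.toFun x - S.toFun y₁‖ ≤ 4 * Δ
    rw [e1, e2, ← dist_eq_norm]
    exact hd₁.le
  refine (hgood.union hX).mono (by norm_num) ?_
  rintro x ⟨s, t, hs, hst, ht, hd, hx⟩
  have hp := hpath s t hs hst ht hd
  by_cases hz : ∃ x' ∈ Set.Icc s t, dist (P.toFun x') (S.toFun ε') < 4 * Δ
  · obtain ⟨x', hx', hd'⟩ := hz
    exact Or.inl (mem_covA_of_horizontal (hstrip _ _ _ hε) (hstrip _ _ _ hη) hA (hp.mono hA) hs ht
      hx hx' hd')
  · push Not at hz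
    refine Or.inr ⟨s, t, hs, hst, ht, hd, hx, fun z hzm => le_antisymm ?_ (hz z hzm)⟩
    obtain ⟨w, g1, g2⟩ := hp.exists_split_fst hzm
    obtain rfl : w = ε' := le_antisymm g2.le.2 g1.le.2
    rw [dist_eq_norm]
    exact g1.right_mem.2.2

end PolygonalCurve

/-! ### Eight candidates suffice -/

theorem mainTheorem5 {d : ℕ} (ℓ : ℕ) (hℓ : 2 ≤ ℓ) (α Δ : ℝ) (hα : 1 ≤ α) (hΔ : 0 < Δ)
    (P S : PolygonalCurve d) (hS : PolygonalCurve.IsSimplification Δ ℓ S P)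
    (A : Set (ℝ × ℝ)) (hA : PolygonalCurve.IsApproxFreeSpace α (4 * Δ) S P A)
    (hAclosed : IsClosed A)
    (E : Fin S.numEdges → Finset ℝ) (hE : S.IsExtremalSuperset P A E)
    (π : PolygonalCurve d) (hπ : π.complexity ≤ ℓ) :
    ∃ Sπ : Finset (ℝ × ℝ), (Sπ : Set (ℝ × ℝ)) ⊆ S.candidates ℓ E ∧ Sπ.card ≤ 8 ∧
      P.cov π.toFun Δ ⊆ ⋃ c ∈ Sπ, PolygonalCurve.covA A c.1 c.2 ∧
      (⋃ c ∈ Sπ, PolygonalCurve.covA A c.1 c.2) ⊆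
        ⋃ c ∈ Sπ, P.cov (S.sub c.1 c.2) (4 * α * Δ) := by
  suffices h : S.Covered ℓ E A 8 (P.cov π.toFun Δ) by
    obtain ⟨F, h1, h2, h3⟩ := h
    refine ⟨F, h1, h2, h3, Set.iUnion₂_mono fun c _ => ?_⟩
    refine covA_subset_cov ?_ c.1 c.2
    rw [show 4 * α * Δ = α * (4 * Δ) by ring]
    exact hA.subset_freeSpace
  rcases (P.cov π.toFun Δ).eq_empty_or_nonempty with hempty | ⟨-, s, t, hs, hst, ht, hd, -⟩
  · rw [hempty]
    exact PolygonalCurve.covered_empty.mono (by norm_num) le_rfl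
  rw [frechetDist_comm] at hd
  obtain ⟨s', t', hs', hst', ht', hd', hcomp⟩ := hS.2 π hπ s t hs hst ht hd
  have hπc : Continuous fun u : I => π.toFun u :=
    π.continuousOn.comp_continuous continuous_subtype_val fun u => u.2
  have hπS : frechetDist π.toFun (S.sub s' t') ≤ ENNReal.ofReal (3 * Δ) := by
    refine (frechetDist_triangle (P.continuous_sub ⟨hs, hst.trans ht⟩ ⟨hs.trans hst, ht⟩)).trans
      ((add_le_add hd hd').trans_eq ?_)
    rw [← ENNReal.ofReal_add hΔ.le (by linarith)]
    ring_nf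
  have hpath : ∀ a c, 0 ≤ a → a ≤ c → c ≤ 1 →
      frechetDist (P.sub a c) π.toFun ≤ ENNReal.ofReal Δ →
      UpPath (S.freeSpace P (4 * Δ)) (a, s') (c, t') := by
    intro a c ha hac hc hac'
    refine upPath_of_frechetDist_le (by linarith) ha hac hc hs' hst' ht' ?_
    refine (frechetDist_triangle hπc).trans ((add_le_add hac' hπS).trans_eq ?_)
    rw [← ENNReal.ofReal_add hΔ.le (by linarith)]
    ring_nf
  have hstrip := fun (j : Fin S.numEdges) (ε ε' : ℝ) (h : IsConsecutive (E j) ε ε') =>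
    PolygonalCurve.isStrip_of_isConsecutive hA hAclosed hE h
  have hknot := PolygonalCurve.knot_mem_extremalSuperset hΔ hS.1 hA hAclosed hE
  rcases hst'.eq_or_lt with rfl | hlt
  · refine PolygonalCurve.covered_cov_of_horizontal hℓ hΔ hE hstrip hknot hA.freeSpace_subset hS.1
      ⟨hs', ht'⟩ ?_ hpath
    have h0 := (edist_zero_le_frechetDist _ _).trans hπS
    rw [edist_dist, ENNReal.ofReal_le_ofReal_iff (by linarith)] at h0
    simpa [PolygonalCurve.sub] using h0
  · refine (PolygonalCurve.covered_upCov_of_lt hℓ hE hstrip hknot hs' hlt ht' hcomp).mono le_rfl ?_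
    rintro x ⟨a, c, ha, hac, hc, hac', hx⟩
    exact ⟨a, c, (hpath a c ha hac hc hac').mono hA.freeSpace_subset, hx⟩
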